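/- **Setting.** Let $N>1$ and write $\mathbb R^N=\mathbb R^{N-1}\times\mathbb R$. Let $G:\mathbb R^N\to[0,+\infty)$ be of class $C^\infty$ with $\operatorname{supp}G=\overline{B_1(0)}$ (the closed unit ball), $G(-x)=G(x)$ and $\int_{\mathbb R^N}G\,dx=1$, and put $G_\varepsilon(x)=\varepsilon^{-N}G(x/\varepsilon)$ for $\varepsilon>0$. Let $f:[0,+\infty)\to\mathbb R$ be continuous and non-decreasing with $f(0)=0$, and let $\Omega\subset\mathbb R^N$ be open and bounded. For measurable $E\subseteq\mathbb R^N$ put $$\mathscr F_\varepsilon(E)=\frac1\varepsilon\int_{E^c\cap\Omega}f\big(G_\varepsilon*\chi_{E\cap\Omega}\big)\,dx\in[0,+\infty].$$ A unit vector $\nu$ is an outer normal to $E$ at $x$ if $(x-E)/r\to\{y:\ y\cdot\nu\ge0\}$ in $L^1_{\rm loc}(\mathbb R^N)$ as $r\to0^+$; the reduced boundary $\partial^*E$ is the set of points $x$ at which such a vector exists, and it is then unique and denoted $\nu_E(x)$. Put $$\theta(\nu)=\int_0^1 f\Big(\int_{\{x\cdot\nu\ge t\}}G(x)\,dx\Big)dt\quad(|\nu|=1),\qquad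 \mathscr F(E)=\int_{\partial^*E\cap\Omega}\theta(\nu_E(x))\,d\mathcal H^{N-1}(x)\in[0,+\infty],$$ where $\mathcal H^{N-1}$ is the Hausdorff measure, normalized to agree with Lebesgue measure on $\mathbb R^{N-1}$. **Theorem 3.2 (Lower estimate).** Let $D\subset\mathbb R^{N-1}$ be open and bounded with Lipschitz boundary. Let $u_h,u\in C^{1,1}(D)$ ($h\in\mathbb N$), i.e. continuously differentiable on $D$ with gradient Lipschitz on $D$, with $u_h,u>0$ on $D$ and $u_h\to u$ uniformly in $C^1(D)$, i.e. $u_h\to u$ and $\nabla u_h\to\nabla u$ uniformly on $D$. Let $$E_h=\{(x,y)\in\mathbb R^{N-1}\times\mathbb R:\ x\in D,\ 0\le y\le u_h(x)\},\qquad E=\{(x,y)\in\mathbb R^{N-1}\times\mathbb R:\ x\in D,\ 0\le y\le u(x)\}.$$ Then, for every sequence $(\varepsilon_h)$ of positive numbers with $\varepsilon_h\to0$, $$\liminf_{h\to+\infty}\mathscr F_{\varepsilon_h}(E_h)\ \ge\ \mathscr F(E).$$ -/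

import Mathlib

open MeasureTheory Filter Topology Set Metric
open scoped ENNReal NNReal

noncomputable section

section Functionals

variable {V : Type*} [NormedAddCommGroup V] [InnerProductSpace ℝ V] [FiniteDimensional ℝ V]
  [MeasurableSpace V] [BorelSpace V]

/-- The hypotheses on the kernel `G : V → [0, ∞)`: it is smooth, its support is the closed unit
ball, it is even and its integral is `1`. -/
structure IsInteractionKernel (G : V → ℝ) : Prop where
  nonneg : ∀ x, 0 ≤ G x
  smooth : ContDiff ℝ ((⊤ : ℕ∞) : WithTop ℕ∞) G
  support_eq : tsupport G = closedBall (0 : V) 1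
  even : ∀ x, G (-x) = G x
  integral_eq_one : ∫ x, G x = 1

/-- The hypotheses on `f : [0, ∞) → ℝ`; only the values on `[0, ∞)` matter. -/
structure IsInteractionProfile (f : ℝ → ℝ) : Prop where
  continuousOn : ContinuousOn f (Ici 0)
  monotoneOn : MonotoneOn f (Ici 0)
  map_zero : f 0 = 0

/-- The rescaled kernel `G_ε(x) = ε⁻ᴺ G(x / ε)`, where `N = dim V`. -/
def rescaledKernel (G : V → ℝ) (ε : ℝ) (x : V) : ℝ :=
  (1 / ε ^ Module.finrank ℝ V) * G (ε⁻¹ • x)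

/-- The functional `F_ε(E) = ε⁻¹ ∫_{Eᶜ ∩ Ω} f (G_ε ∗ χ_{E ∩ Ω}) dx`. The integrand is nonnegative
and the value is taken in `[0, ∞]`. -/
def nonlocalEnergy (G : V → ℝ) (f : ℝ → ℝ) (Ω : Set V) (ε : ℝ) (E : Set V) : ℝ≥0∞ :=
  (ENNReal.ofReal ε)⁻¹ * ∫⁻ x in Eᶜ ∩ Ω, ENNReal.ofReal
    (f (convolution (rescaledKernel G ε) ((E ∩ Ω).indicator (fun _ => (1 : ℝ)))
      (ContinuousLinearMap.mul ℝ ℝ) volume x))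

/-- The anisotropy `θ(ν) = ∫₀¹ f (∫_{x · ν ≥ t} G(x) dx) dt`. -/
def surfaceDensity (G : V → ℝ) (f : ℝ → ℝ) (ν : V) : ℝ :=
  ∫ t in (0 : ℝ)..1, f (∫ x in {x : V | t ≤ inner ℝ x ν}, G x)

/-- `ν` is an outer unit normal to `E` at `x`: it is a unit vector, and the blow-ups `(x - E) / r`
converge in `L¹_loc` to the half-space `{y | y · ν ≥ 0}` as `r → 0⁺`. -/
def IsOuterNormal (E : Set V) (x ν : V) : Prop :=
  ‖ν‖ = 1 ∧ ∀ R : ℝ, 0 < R →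
    Tendsto (fun r : ℝ => volume
      (symmDiff {y : V | x - r • y ∈ E} {y : V | 0 ≤ inner ℝ y ν} ∩ ball 0 R))
      (𝓝[>] 0) (𝓝 0)

/-- The reduced boundary `∂*E`: the points at which `E` has an outer unit normal. -/
def reducedBoundary (E : Set V) : Set V :=
  {x | ∃ ν, IsOuterNormal E x ν}

open Classical in
/-- The outer unit normal `ν_E(x)` at points `x` of the reduced boundary (and `0` elsewhere). -/
def outerNormal (E : Set V) (x : V) : V :=
  if h : ∃ ν, IsOuterNormal E x ν then h.choose else 0

/-- The limit functional `F(E) = ∫_{∂*E ∩ Ω} θ(ν_E(x)) dℋᴺ⁻¹(x)`, where `ℋᴺ⁻¹` is the Hausdorff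
measure normalized so as to agree with the Lebesgue measure on Euclidean spaces of dimension
`N - 1`. -/
def anisotropicPerimeter (G : V → ℝ) (f : ℝ → ℝ) (Ω : Set V) (E : Set V) : ℝ≥0∞ :=
  ∫⁻ x in reducedBoundary E ∩ Ω, ENNReal.ofReal (surfaceDensity G f (outerNormal E x))
    ∂(μHE[Module.finrank ℝ V - 1] : Measure V)

end Functionals

section Graphs

variable {W : Type*} [NormedAddCommGroup W] [InnerProductSpace ℝ W]

/-- The set `D` has Lipschitz boundary: near each boundary point, in some system of orthogonal
coordinates, `D` is the region on one side of the graph of a Lipschitz function. Here `e` is the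
vertical direction, `x - ⟪x, e⟫ e` is the horizontal part of `x`. -/
def HasLipschitzBoundary (D : Set W) : Prop :=
  ∀ x₀ ∈ frontier D, ∃ r : ℝ, 0 < r ∧ ∃ e : W, ‖e‖ = 1 ∧ ∃ (K : ℝ≥0) (g : W → ℝ),
    LipschitzWith K g ∧
      ∀ x ∈ ball x₀ r, (x ∈ D ↔ inner ℝ x e < g (x - (inner ℝ x e : ℝ) • e))

/-- `u` is of class `C^{1,1}` on the open set `D`: it is continuously differentiable there and its
derivative is Lipschitz on `D`. -/
def IsC11On (u : W → ℝ) (D : Set W) : Prop :=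
  ContDiffOn ℝ 1 u D ∧ ∃ K : ℝ≥0, LipschitzOnWith K (fderiv ℝ u) D

/-- `u_h → u` uniformly in `C¹(D)`: the functions and their derivatives converge uniformly. -/
def TendstoInC1On (uₕ : ℕ → W → ℝ) (u : W → ℝ) (D : Set W) : Prop :=
  TendstoUniformlyOn uₕ u atTop D ∧
    TendstoUniformlyOn (fun h => fderiv ℝ (uₕ h)) (fderiv ℝ u) atTop D

/-- The set `{(x, y) | x ∈ D, 0 ≤ y ≤ u(x)}` in `W × ℝ` with its Euclidean norm. -/
def subgraphOver (D : Set W) (u : W → ℝ) : Set (WithLp 2 (W × ℝ)) :=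
  {z | z.fst ∈ D ∧ 0 ≤ z.snd ∧ z.snd ≤ u z.fst}

end Graphs

end

open MeasureTheory Filter Topology Set Metric
open scoped ENNReal NNReal

/-! Near almost every point of the reduced boundary, E and the E_h are, in suitable orthogonal
coordinates, the regions below graphs of g and g_h, where g is Lipschitz and the difference
quotients of g_h at scale ε_h converge to the derivative of g (`IsGraphChart`). Put J = √(1 +
|∇g|²). Seen from height ε_h J(p) t above the graph of g_h and blown up by 1/ε_h, the sets converge
to a half-space, so the nonlocal density tends to the mass of G in {x · ν ≥ t}
(`tendsto_kernelAverage`). The substitution y = g_h(p) + ε_h J(p) t absorbs the factor 1/ε_h and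
leaves J; keeping only 0 < t ≤ 1, Fatou's lemma bounds the liminf below by the integral of J θ(ν) dp
(`IsGraphChart.lintegral_graphDensity_le_liminf`).

Since the surface integral is the smaller side, only one half of the area formula is needed
(`setLIntegral_range_le_lintegral_graph`). The local estimates are added up with a countable
partition of unity and the superadditivity of liminf (`anisotropicPerimeter_le_liminf_of_charts`).

Charts exist over the interior of D, at the bottom and at the top, and on the lateral wall strictly
between them. What remains are the edges, which are null (`exists_null_forall_exists_isGraphChart`).
To locate the top edge, u is extended continuously across ∂D: its gradient is bounded, and nearby
points of a Lipschitz domain are joined inside it by paths of comparable length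
(`exists_lipschitzOnWith_inter_ball`). -/

noncomputable section

/-! ### The area inequality for Lipschitz graphs. -/

section AreaInequality

/-- The Jacobian factor `√(1 + ‖a‖²)` of the graph of an affine function with slope `a`. -/
def graphJacobian {W : Type*} [NormedAddCommGroup W] [InnerProductSpace ℝ W] (a : W →L[ℝ] ℝ) : ℝ :=
  √(1 + ‖a‖ ^ 2)

section GraphJacobian

variable {W : Type*} [NormedAddCommGroup W] [InnerProductSpace ℝ W]

theorem graphJacobian_sq (a : W →L[ℝ] ℝ) : graphJacobian a ^ 2 = 1 + ‖a‖ ^ 2 :=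
  Real.sq_sqrt (by positivity)

theorem one_le_graphJacobian (a : W →L[ℝ] ℝ) : 1 ≤ graphJacobian a :=
  Real.one_le_sqrt.2 (by nlinarith [sq_nonneg ‖a‖])

theorem graphJacobian_pos (a : W →L[ℝ] ℝ) : 0 < graphJacobian a :=
  zero_lt_one.trans_le (one_le_graphJacobian a)

/-- The Jacobian is the Euclidean norm of (1, ‖a‖), hence 1-Lipschitz in the slope. This pays for
exchanging an approximating slope for the true derivative. -/
theorem graphJacobian_le_add (a b : W →L[ℝ] ℝ) :
    graphJacobian a ≤ graphJacobian b + ‖b - a‖ := by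
  have h1 := graphJacobian_sq a
  have h2 := graphJacobian_sq b
  have h3 := graphJacobian_pos a
  have h4 := graphJacobian_pos b
  have h5 : ‖a‖ ≤ ‖b‖ + ‖b - a‖ := by
    exact norm_le_norm_add_norm_sub b a
  have h6 : ‖b‖ ≤ graphJacobian b := Real.le_sqrt_of_sq_le (by linarith)
  have h7 := norm_nonneg (b - a)
  refine abs_le_of_sq_le_sq' ?_ (by positivity) |>.2
  nlinarith [norm_nonneg a, norm_nonneg b, pow_le_pow_left₀ (norm_nonneg a) h5 2]

theorem continuous_graphJacobian : Continuous (graphJacobian : (W →L[ℝ] ℝ) → ℝ) := by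
  unfold graphJacobian
  fun_prop

/-- There is a linear map of determinant `√(1 + ‖a‖²)` which stretches lengths as the parametrization
`x ↦ (x, a x)` of the graph of `a` does. -/
theorem exists_linearMap_norm_sq_eq [FiniteDimensional ℝ W] (a : W →L[ℝ] ℝ) :
    ∃ T : W →ₗ[ℝ] W, (∀ x, ‖T x‖ ^ 2 = ‖x‖ ^ 2 + a x ^ 2) ∧ LinearMap.det T = graphJacobian a := by
  set w : W := (InnerProductSpace.toDual ℝ W).symm a with hw
  have haw : ∀ x, inner ℝ w x = a x := fun x => by simp [hw]
  have hnw : ‖w‖ = ‖a‖ := by simp [hw]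
  set J := graphJacobian a with hJ
  have hJ2 : J ^ 2 = 1 + ‖a‖ ^ 2 := graphJacobian_sq a
  have hJ0 : 0 < J := graphJacobian_pos a
  have hJ1 : (J + 1) ≠ 0 := by positivity
  -- The map id + c a(·)w fixes the complement of w and stretches w by 1 + c‖a‖² = 1 + (J² - 1)/(J +
  -- 1) = J.
  set c : ℝ := 1 / (J + 1) with hc
  have hcJ : c * (J + 1) = 1 := by rw [hc]; field_simp
  have haww : a w = ‖a‖ ^ 2 := by rw [← haw, real_inner_self_eq_norm_sq, hnw]
  refine ⟨LinearMap.transvection (a : W →ₗ[ℝ] ℝ) (c • w), fun x => ?_, ?_⟩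
  · have : LinearMap.transvection (a : W →ₗ[ℝ] ℝ) (c • w) x = x + (a x * c) • w := by
      simp [LinearMap.transvection.apply, smul_smul]
    rw [this, @norm_add_sq_real, inner_smul_right, real_inner_comm, haw, norm_smul, hnw, mul_pow,
      Real.norm_eq_abs, sq_abs]
    have : ‖a‖ ^ 2 = J ^ 2 - 1 := by linarith
    rw [this]
    linear_combination a x ^ 2 * (c * (J - 1) + 1) * hcJ
  · rw [LinearMap.transvection.det]
    simp only [ContinuousLinearMap.coe_coe, map_smul, smul_eq_mul, haww]
    have : ‖a‖ ^ 2 = J ^ 2 - 1 := by linarith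
    rw [this]
    linear_combination (J - 1) * hcJ

end GraphJacobian

variable {n : ℕ} {X : Type*} [MetricSpace X] [MeasurableSpace X] [BorelSpace X]
  {g : EuclideanSpace ℝ (Fin n) → ℝ} {φ : EuclideanSpace ℝ (Fin n) → X}

theorem LipschitzOnWith.euclideanHausdorffMeasure_image_le {Y : Type*} [MetricSpace Y]
    [MeasurableSpace Y] [BorelSpace Y] {ψ : Y → X} {K : ℝ≥0} {s : Set Y}
    (h : LipschitzOnWith K ψ s) (d : ℕ) :
    (μHE[d] : Measure X) (ψ '' s) ≤ (K : ℝ≥0∞) ^ d * (μHE[d] : Measure Y) s := by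
  have := h.hausdorffMeasure_image_le (d := d) (by positivity)
  rw [Measure.euclideanHausdorffMeasure_def, Measure.euclideanHausdorffMeasure_def,
    Measure.smul_apply, Measure.smul_apply]
  simp only [ENNReal.rpow_natCast] at this
  rw [ENNReal.smul_def, ENNReal.smul_def, smul_eq_mul, smul_eq_mul, mul_left_comm]
  gcongr

/-- The linear map T of `exists_linearMap_norm_sq_eq` distorts lengths exactly as the affine graph
does, so φ ∘ T⁻¹ is (1 + δ)-Lipschitz on T(s), whose volume is the Jacobian times that of s. -/
theorem euclideanHausdorffMeasure_image_le_of_approximatesLinearOn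
    (hφ : ∀ x y, dist (φ x) (φ y) ^ 2 = ‖x - y‖ ^ 2 + (g x - g y) ^ 2)
    {a : EuclideanSpace ℝ (Fin n) →L[ℝ] ℝ} {s : Set (EuclideanSpace ℝ (Fin n))} {δ : ℝ≥0}
    (h : ApproximatesLinearOn g a s δ) :
    (μHE[n] : Measure X) (φ '' s) ≤
      (1 + δ : ℝ≥0∞) ^ n * (ENNReal.ofReal (graphJacobian a) * volume s) := by
  obtain ⟨T, hT, hdet⟩ := exists_linearMap_norm_sq_eq a
  have hle : ∀ x, ‖x‖ ≤ ‖T x‖ := fun x =>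
    abs_le_of_sq_le_sq' (by nlinarith [hT x, sq_nonneg (a x)]) (norm_nonneg _) |>.2
  have hle' : ∀ x, |a x| ≤ ‖T x‖ := fun x =>
    abs_le_of_sq_le_sq (by nlinarith [hT x, sq_nonneg ‖x‖]) (norm_nonneg _)
  have hinj : Function.Injective T := by
    rw [← LinearMap.ker_eq_bot, LinearMap.ker_eq_bot']
    intro x hx
    have := hle x
    rw [hx, norm_zero] at this
    exact norm_le_zero_iff.1 this
  have hinv := Function.leftInverse_invFun hinj
  have himg : φ '' s = (φ ∘ Function.invFun T) '' (T '' s) := by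
    rw [← image_comp]
    refine image_congr fun x _ => ?_
    simp [hinv x]
  have hlip : LipschitzOnWith (1 + δ) (φ ∘ Function.invFun T) (T '' s) := by
    refine LipschitzOnWith.of_dist_le_mul ?_
    rintro _ ⟨x, hx, rfl⟩ _ ⟨y, hy, rfl⟩
    simp only [Function.comp_apply, hinv x, hinv y]
    rw [dist_eq_norm, ← map_sub]
    have h1 := h x hx y hy
    rw [Real.norm_eq_abs] at h1
    have h2 := hT (x - y)
    have h3 := hle (x - y)
    have h4 := hle' (x - y)
    have h5 := hφ x y
    set N := ‖T (x - y)‖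
    set v := ‖x - y‖
    have hN : 0 ≤ N := norm_nonneg _
    have hv : 0 ≤ v := norm_nonneg _
    have hδ : (0 : ℝ) ≤ δ := δ.2
    have h6 : |g x - g y - a (x - y)| ≤ δ * N := h1.trans (by gcongr)
    set b := g x - g y
    set e := b - a (x - y) with he
    have h7 : a (x - y) * e ≤ N * (δ * N) := by
      calc _ ≤ |a (x - y) * e| := le_abs_self _
        _ = |a (x - y)| * |e| := abs_mul _ _
        _ ≤ _ := by gcongr
    have h8 : e ^ 2 ≤ (δ * N) ^ 2 := sq_le_sq.2 (by rwa [abs_of_nonneg (a := δ * N) (by positivity)])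
    -- As N² = v² + a(x - y)², the squared distance is N² + 2 a(x - y) e + e² ≤ (1 + δ)² N².
    refine abs_le_of_sq_le_sq' ?_ (by positivity) |>.2
    have hb : b = a (x - y) + e := by rw [he]; ring
    rw [h5, hb]
    push_cast
    nlinarith
  rw [himg]
  refine (LipschitzOnWith.euclideanHausdorffMeasure_image_le hlip n).trans ?_
  rw [EuclideanSpace.euclideanHausdorffMeasure_eq_volume, Measure.addHaar_image_linearMap, hdet,
    abs_of_pos (graphJacobian_pos a)]
  simp

/-- To prove an inequality between the measure of an image and a set integral, it is enough to prove
it on the pieces of a countable measurable partition. -/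
theorem measure_image_le_mul_setLIntegral_of_partition {α β : Type*} [MeasurableSpace α]
    [MeasurableSpace β] {μ : Measure α} {ν : Measure β} {φ : α → β} {F : α → ℝ≥0∞} {c : ℝ≥0∞}
    {s : Set α} (hs : MeasurableSet s) {t : ℕ → Set α} (ht : ∀ k, MeasurableSet (t k))
    (htd : Pairwise (Function.onFun Disjoint t)) (hst : s ⊆ ⋃ k, t k)
    (h : ∀ k, ν (φ '' (s ∩ t k)) ≤ c * ∫⁻ x in s ∩ t k, F x ∂μ) :
    ν (φ '' s) ≤ c * ∫⁻ x in s, F x ∂μ := by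
  have hcover : s = ⋃ k, s ∩ t k := by rw [← inter_iUnion, inter_eq_left.2 hst]
  have hdisj : Pairwise (Function.onFun Disjoint fun k => s ∩ t k) := fun i j hij =>
    (htd hij).mono inter_subset_right inter_subset_right
  calc ν (φ '' s) = ν (⋃ k, φ '' (s ∩ t k)) := by rw [← image_iUnion, ← hcover]
    _ ≤ ∑' k, ν (φ '' (s ∩ t k)) := measure_iUnion_le _
    _ ≤ ∑' k, c * ∫⁻ x in s ∩ t k, F x ∂μ := ENNReal.tsum_le_tsum h
    _ = _ := by
      rw [ENNReal.tsum_mul_left, ← lintegral_iUnion (fun k => hs.inter (ht k)) hdisj, ← hcover]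

/-- Two successive partitions: one on which the derivative oscillates by less than δ, then one on
which g is δ-close to affine. The affine slope is the derivative at some point of the first piece,
so it can be replaced by the derivative at x at the cost of δ. -/
theorem euclideanHausdorffMeasure_image_le_mul_lintegral_add
    (hφ : ∀ x y, dist (φ x) (φ y) ^ 2 = ‖x - y‖ ^ 2 + (g x - g y) ^ 2)
    {s : Set (EuclideanSpace ℝ (Fin n))} (hs : MeasurableSet s)
    (hg : ∀ x ∈ s, DifferentiableAt ℝ g x) {δ : ℝ≥0} (hδ : 0 < δ) :
    (μHE[n] : Measure X) (φ '' s) ≤ (1 + δ : ℝ≥0∞) ^ n *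
      ∫⁻ x in s, (ENNReal.ofReal (graphJacobian (fderiv ℝ g x)) + δ) := by
  set q := TopologicalSpace.denseSeq (EuclideanSpace ℝ (Fin n) →L[ℝ] ℝ)
  have hδ' : (0 : ℝ) < δ := hδ
  set P : ℕ → Set (EuclideanSpace ℝ (Fin n)) :=
    disjointed fun k => fderiv ℝ g ⁻¹' ball (q k) (δ / 2)
  have hP : ∀ k, MeasurableSet (P k) := fun k =>
    MeasurableSet.disjointed (fun i => measurable_fderiv ℝ g measurableSet_ball) k
  have hPs : ∀ k, P k ⊆ fderiv ℝ g ⁻¹' ball (q k) (δ / 2) := disjointed_subset _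
  refine measure_image_le_mul_setLIntegral_of_partition hs hP (disjoint_disjointed _) ?_ ?_
  · rw [iUnion_disjointed]
    intro x _
    obtain ⟨k, hk⟩ := (TopologicalSpace.denseRange_denseSeq
      (EuclideanSpace ℝ (Fin n) →L[ℝ] ℝ)).exists_dist_lt (fderiv ℝ g x) (half_pos hδ')
    exact mem_iUnion.2 ⟨k, hk⟩
  intro j
  obtain ⟨t, A, ht_disj, ht_meas, ht_cover, ht_approx, ht_slope⟩ :=
    exists_partition_approximatesLinearOn_of_hasFDerivWithinAt g (s ∩ P j) (fderiv ℝ g)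
      (fun x hx => (hg x hx.1).hasFDerivAt.hasFDerivWithinAt) (fun _ => δ) (fun _ => hδ.ne')
  refine measure_image_le_mul_setLIntegral_of_partition (hs.inter (hP j)) ht_meas ht_disj ht_cover
    fun k => ?_
  rcases (s ∩ P j).eq_empty_or_nonempty with hempty | hne
  · simp [hempty]
  obtain ⟨y, hy, hAy⟩ := ht_slope hne k
  refine (euclideanHausdorffMeasure_image_le_of_approximatesLinearOn hφ (ht_approx k)).trans ?_
  gcongr
  rw [← setLIntegral_const]
  refine setLIntegral_mono' ((hs.inter (hP j)).inter (ht_meas k)) fun x hx => ?_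
  have h1 := graphJacobian_le_add (A k) (fderiv ℝ g x)
  have h2 : ‖fderiv ℝ g x - A k‖ ≤ δ := by
    rw [hAy, ← dist_eq_norm]
    have h3 : dist (fderiv ℝ g x) (q j) < δ / 2 := hPs j hx.1.2
    have h4 : dist (fderiv ℝ g y) (q j) < δ / 2 := hPs j hy.2
    linarith [dist_triangle_right (fderiv ℝ g x) (fderiv ℝ g y) (q j)]
  calc ENNReal.ofReal (graphJacobian (A k))
      ≤ ENNReal.ofReal (graphJacobian (fderiv ℝ g x) + δ) :=
        ENNReal.ofReal_le_ofReal (by linarith)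
    _ ≤ ENNReal.ofReal (graphJacobian (fderiv ℝ g x)) + ENNReal.ofReal δ :=
        ENNReal.ofReal_add_le
    _ = _ := by simp

/-- The area inequality for the graph of a real function, parametrized by `φ`. -/
theorem euclideanHausdorffMeasure_image_le_lintegral
    (hφ : ∀ x y, dist (φ x) (φ y) ^ 2 = ‖x - y‖ ^ 2 + (g x - g y) ^ 2)
    {s : Set (EuclideanSpace ℝ (Fin n))} (hs : MeasurableSet s)
    (hg : ∀ x ∈ s, DifferentiableAt ℝ g x) :
    (μHE[n] : Measure X) (φ '' s) ≤ ∫⁻ x in s, ENNReal.ofReal (graphJacobian (fderiv ℝ g x)) := by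
  -- On pieces of finite volume the error δ · volume vanishes as δ → 0.
  set B := disjointed (spanningSets (volume : Measure (EuclideanSpace ℝ (Fin n))))
  have hB : ∀ k, MeasurableSet (B k) := fun k =>
    MeasurableSet.disjointed (measurableSet_spanningSets volume) k
  rw [← one_mul (lintegral _ _)]
  refine measure_image_le_mul_setLIntegral_of_partition hs hB (disjoint_disjointed _) ?_ fun k => ?_
  · rw [iUnion_disjointed, iUnion_spanningSets]
    exact subset_univ _
  rw [one_mul]
  have hfin : volume (s ∩ B k) ≠ ∞ :=
    ne_top_of_le_ne_top (measure_spanningSets_lt_top volume k).ne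
      (measure_mono (inter_subset_right.trans (disjointed_subset _ _)))
  set I := ∫⁻ x in s ∩ B k, ENNReal.ofReal (graphJacobian (fderiv ℝ g x))
  have key : ∀ δ : ℝ≥0, 0 < δ → (μHE[n] : Measure X) (φ '' (s ∩ B k)) ≤
      (1 + δ : ℝ≥0∞) ^ n * (I + δ * volume (s ∩ B k)) := fun δ hδ => by
    refine (euclideanHausdorffMeasure_image_le_mul_lintegral_add hφ (hs.inter (hB k))
      (fun x hx => hg x hx.1) hδ).trans_eq ?_
    rw [lintegral_add_right _ measurable_const, setLIntegral_const]
  have hlim : Tendsto (fun δ : ℝ≥0 => (1 + δ : ℝ≥0∞) ^ n * (I + δ * volume (s ∩ B k))) (𝓝[>] 0)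
      (𝓝 ((1 + (0 : ℝ≥0) : ℝ≥0∞) ^ n * (I + (0 : ℝ≥0) * volume (s ∩ B k)))) := by
    refine Tendsto.mono_left ?_ nhdsWithin_le_nhds
    have h0 : Tendsto (fun δ : ℝ≥0 => (δ : ℝ≥0∞)) (𝓝 0) (𝓝 ((0 : ℝ≥0) : ℝ≥0∞)) :=
      ENNReal.tendsto_coe.2 tendsto_id
    refine ENNReal.Tendsto.mul ?_ (Or.inl ?_) ?_ (Or.inr ?_)
    · exact ((ENNReal.continuous_pow n).tendsto _).comp (tendsto_const_nhds.add h0)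
    · simp
    · exact tendsto_const_nhds.add (ENNReal.Tendsto.mul_const h0 (Or.inr hfin))
    · simp
  have := ge_of_tendsto hlim (eventually_of_mem self_mem_nhdsWithin fun δ hδ => key δ hδ)
  simpa using this

omit [MeasurableSpace X] [BorelSpace X] in
theorem lipschitzWith_of_dist_sq_eq {K : ℝ≥0} (hgK : LipschitzWith K g)
    (hφ : ∀ x y, dist (φ x) (φ y) ^ 2 = ‖x - y‖ ^ 2 + (g x - g y) ^ 2) :
    LipschitzWith (1 + K) φ := by
  refine LipschitzWith.of_dist_le_mul fun x y => ?_
  have h1 := hgK.dist_le_mul x y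
  rw [Real.dist_eq, dist_eq_norm] at h1
  rw [dist_eq_norm x y]
  have h2 : (g x - g y) ^ 2 ≤ (K * ‖x - y‖) ^ 2 := by
    rw [← sq_abs]
    gcongr
  refine abs_le_of_sq_le_sq' ?_ (by positivity) |>.2
  rw [hφ]
  push_cast
  nlinarith [mul_nonneg K.2 (sq_nonneg ‖x - y‖)]

theorem euclideanHausdorffMeasure_image_eq_zero {K : ℝ≥0} (hφ : LipschitzWith K φ)
    {s : Set (EuclideanSpace ℝ (Fin n))} (hs : volume s = 0) :
    (μHE[n] : Measure X) (φ '' s) = 0 := by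
  refine le_antisymm ((LipschitzOnWith.euclideanHausdorffMeasure_image_le
    (hφ.lipschitzOnWith (s := s)) n).trans ?_) zero_le
  rw [EuclideanSpace.euclideanHausdorffMeasure_eq_volume, hs, mul_zero]

/-- Change of variables inequality for integrals over the graph of a Lipschitz function,
parametrized by `φ`. -/
theorem setLIntegral_range_le_lintegral_graph {K : ℝ≥0} (hgK : LipschitzWith K g)
    (hφ : ∀ x y, dist (φ x) (φ y) ^ 2 = ‖x - y‖ ^ 2 + (g x - g y) ^ 2)
    {F : X → ℝ≥0∞} (hF : Measurable F) :
    ∫⁻ z in range φ, F z ∂(μHE[n] : Measure X) ≤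
      ∫⁻ x, ENNReal.ofReal (graphJacobian (fderiv ℝ g x)) * F (φ x) := by
  have hφlip := lipschitzWith_of_dist_sq_eq hgK hφ
  have hnull := euclideanHausdorffMeasure_image_eq_zero hφlip (ae_iff.1 hgK.ae_differentiableAt)
  have hJ : Measurable fun x => ENNReal.ofReal (graphJacobian (fderiv ℝ g x)) :=
    ENNReal.measurable_ofReal.comp
      (continuous_graphJacobian.measurable.comp (measurable_fderiv ℝ g))
  set ν : Measure X :=
    (volume.withDensity fun x => ENNReal.ofReal (graphJacobian (fderiv ℝ g x))).map φ with hν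
  -- Domination of measures, checked on Borel sets, gives the inequality for all integrands at once.
  -- Non-differentiability points are null by Rademacher, and so is their Lipschitz image.
  have hle : (μHE[n] : Measure X).restrict (range φ) ≤ ν := by
    refine Measure.le_iff.2 fun B hB => ?_
    have hpre : MeasurableSet (φ ⁻¹' B) := hφlip.continuous.measurable hB
    rw [Measure.restrict_apply hB, hν, Measure.map_apply hφlip.continuous.measurable hB,
      withDensity_apply _ hpre, ← image_preimage_eq_inter_range]
    set M := {x | DifferentiableAt ℝ g x}
    have hM : MeasurableSet M := measurableSet_of_differentiableAt ℝ g
    calc (μHE[n] : Measure X) (φ '' (φ ⁻¹' B))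
        ≤ (μHE[n] : Measure X) (φ '' (φ ⁻¹' B ∩ M) ∪ φ '' {x | ¬ DifferentiableAt ℝ g x}) := by
          refine measure_mono ?_
          rw [← image_union]
          refine image_mono fun x hx => ?_
          by_cases h : DifferentiableAt ℝ g x
          exacts [Or.inl ⟨hx, h⟩, Or.inr h]
      _ ≤ (μHE[n] : Measure X) (φ '' (φ ⁻¹' B ∩ M)) + 0 := hnull ▸ measure_union_le _ _
      _ ≤ ∫⁻ x in φ ⁻¹' B ∩ M, ENNReal.ofReal (graphJacobian (fderiv ℝ g x)) := by
          rw [add_zero]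
          exact euclideanHausdorffMeasure_image_le_lintegral hφ (hpre.inter hM) fun x hx => hx.2
      _ ≤ _ := lintegral_mono_set inter_subset_left
  refine (lintegral_mono' hle le_rfl).trans_eq ?_
  rw [hν, lintegral_map hF hφlip.continuous.measurable]
  exact lintegral_withDensity_eq_lintegral_mul _ hJ (hF.comp hφlip.continuous.measurable)

end AreaInequality

/-! ### Uniqueness of the outer normal and location of the reduced boundary. -/

section OuterNormal

variable {V : Type*} [NormedAddCommGroup V] [InnerProductSpace ℝ V] [FiniteDimensional ℝ V]
  [MeasurableSpace V] [BorelSpace V]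

theorem volume_setOf_inner_eq {v : V} (hv : v ≠ 0) (s : ℝ) :
    volume {w : V | inner ℝ w v = s} = 0 := by
  have hsurj : Function.Surjective (innerₗ V v) := by
    refine LinearMap.surjective_of_ne_zero fun h => hv ?_
    have : innerₗ V v v = 0 := by rw [h]; rfl
    simpa using this
  have h := (ae_comp_linearMap_mem_iff (innerₗ V v) (volume : Measure V) (volume : Measure ℝ) hsurj
    (measurableSet_singleton s).compl).2 (compl_mem_ae_iff.2 (by simp))
  rw [ae_iff] at h
  convert h using 2
  ext w
  simp [real_inner_comm]

/-- If the blow-ups of `E` at `x` eventually differ from the half-space on a fixed nonempty open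
subset of a ball, then `x` has no such outer normal. -/
theorem not_isOuterNormal_of_eventually_subset {E : Set V} {x ν : V} {R : ℝ} (hR : 0 < R)
    {O : Set V} (hO : IsOpen O) (hne : O.Nonempty)
    (h : ∀ᶠ r : ℝ in 𝓝[>] 0,
      O ⊆ symmDiff {y : V | x - r • y ∈ E} {y : V | 0 ≤ inner ℝ y ν} ∩ ball 0 R) :
    ¬ IsOuterNormal E x ν := by
  intro hν
  have h1 : volume O ≤ 0 := ge_of_tendsto (hν.2 R hR) (h.mono fun r hr => measure_mono hr)
  exact (hO.measure_pos volume hne).not_ge h1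

/-- Where the two half-spaces disagree, a blow-up must differ from one of them, at every scale. That
region contains a nonempty open wedge, through ν - ν', whose norm is at most 2: hence the ball of
radius 3. -/
theorem IsOuterNormal.unique {E : Set V} {x ν ν' : V} (h : IsOuterNormal E x ν)
    (h' : IsOuterNormal E x ν') : ν = ν' := by
  by_contra hne
  set O : Set V := {y | 0 < inner ℝ y ν} ∩ {y | inner ℝ y ν' < 0} ∩ ball 0 3 with hO
  have hOo : IsOpen O := by
    refine (IsOpen.inter ?_ ?_).inter isOpen_ball
    · exact isOpen_lt continuous_const (by fun_prop)
    · exact isOpen_lt (by fun_prop) continuous_const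
  have hlt : inner ℝ ν ν' < 1 := inner_lt_one_iff_real_of_norm_eq_one h.1 h'.1 |>.2 hne
  have hn : inner ℝ ν ν = (1 : ℝ) := by rw [real_inner_self_eq_norm_sq, h.1]; norm_num
  have hn' : inner ℝ ν' ν' = (1 : ℝ) := by rw [real_inner_self_eq_norm_sq, h'.1]; norm_num
  have hOne : O.Nonempty := by
    refine ⟨ν - ν', ⟨?_, ?_⟩, ?_⟩
    · simp only [mem_ofPred_eq, inner_sub_left, hn, real_inner_comm ν ν']
      linarith
    · simp only [mem_ofPred_eq, inner_sub_left, hn']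
      linarith
    · rw [mem_ball_zero_iff]
      linarith [norm_sub_le ν ν', h.1, h'.1]
  have hsub : ∀ r : ℝ, O ⊆
      (symmDiff {y : V | x - r • y ∈ E} {y : V | 0 ≤ inner ℝ y ν} ∩ ball 0 3) ∪
      (symmDiff {y : V | x - r • y ∈ E} {y : V | 0 ≤ inner ℝ y ν'} ∩ ball 0 3) := by
    rintro r y ⟨⟨h1, h2⟩, h3⟩
    simp only [mem_ofPred_eq] at h1 h2
    by_cases hy : x - r • y ∈ E
    · exact Or.inr ⟨Or.inl ⟨hy, not_le.2 h2⟩, h3⟩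
    · exact Or.inl ⟨Or.inr ⟨h1.le, hy⟩, h3⟩
  have hlim := (h.2 3 (by norm_num)).add (h'.2 3 (by norm_num))
  rw [add_zero] at hlim
  have hle : volume O ≤ 0 := ge_of_tendsto hlim
    (Eventually.of_forall fun r => (measure_mono (hsub r)).trans (measure_union_le _ _))
  exact (hOo.measure_pos volume hOne).not_ge hle

theorem IsOuterNormal.outerNormal_eq {E : Set V} {x ν : V} (h : IsOuterNormal E x ν) :
    outerNormal E x = ν := by
  have hex : ∃ ν, IsOuterNormal E x ν := ⟨ν, h⟩
  rw [outerNormal, dif_pos hex]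
  exact hex.choose_spec.unique h

omit [FiniteDimensional ℝ V] [MeasurableSpace V] [BorelSpace V] in
theorem eventually_forall_ball_sub_smul_mem {E : Set V} {x : V} (hx : E ∈ 𝓝 x) :
    ∀ᶠ r : ℝ in 𝓝[>] 0, ∀ y ∈ ball (0 : V) 1, x - r • y ∈ E := by
  obtain ⟨δ, hδ, hsub⟩ := Metric.mem_nhds_iff.1 hx
  filter_upwards [Ioo_mem_nhdsGT hδ] with r hr y hy
  refine hsub ?_
  rw [mem_ball, dist_eq_norm, sub_sub_cancel_left, norm_neg, norm_smul, Real.norm_eq_abs,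
    abs_of_pos hr.1]
  rw [mem_ball_zero_iff] at hy
  nlinarith [hr.1, hr.2, norm_nonneg y]

/-- At interior or exterior points small blow-ups fill or miss the unit ball, so they differ from
any half-space on an open half-ball. -/
theorem reducedBoundary_subset_frontier (E : Set V) : reducedBoundary E ⊆ frontier E := by
  rintro x ⟨ν, hν⟩
  by_contra hx
  have hcases : E ∈ 𝓝 x ∨ Eᶜ ∈ 𝓝 x := by
    by_cases h1 : E ∈ 𝓝 x
    · exact Or.inl h1
    · right
      rw [frontier, Set.mem_sdiff, not_and, not_not, mem_interior_iff_mem_nhds] at hx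
      have : x ∉ closure E := fun h => h1 (hx h)
      rwa [← mem_interior_iff_mem_nhds, interior_compl]
  rcases hcases with h | h
  · refine not_isOuterNormal_of_eventually_subset (ν := ν) one_pos
      (O := {y | inner ℝ y ν < 0} ∩ ball 0 1)
      ((isOpen_lt (by fun_prop) continuous_const).inter isOpen_ball)
      ⟨-(1 / 2 : ℝ) • ν, ?_, ?_⟩ ?_ hν
    · simp [inner_smul_left, hν.1]
    · rw [mem_ball_zero_iff, norm_smul, hν.1]
      norm_num
    · filter_upwards [eventually_forall_ball_sub_smul_mem h] with r hr y hy
      exact ⟨Or.inl ⟨hr y hy.2, not_le.2 (show inner ℝ y ν < 0 from hy.1)⟩, hy.2⟩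
  · refine not_isOuterNormal_of_eventually_subset (ν := ν) one_pos
      (O := {y | 0 < inner ℝ y ν} ∩ ball 0 1)
      ((isOpen_lt continuous_const (by fun_prop)).inter isOpen_ball)
      ⟨(1 / 2 : ℝ) • ν, ?_, ?_⟩ ?_ hν
    · simp [inner_smul_left, hν.1]
    · rw [mem_ball_zero_iff, norm_smul, hν.1]
      norm_num
    · filter_upwards [eventually_forall_ball_sub_smul_mem h] with r hr y hy
      have hy1 : 0 < inner ℝ y ν := hy.1
      exact ⟨Or.inr ⟨hy1.le, hr y hy.2⟩, hy.2⟩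

end OuterNormal

/-! ### Subgraphs in orthogonal coordinates and their blow-ups. -/

section GraphChart

/-- The space `ℝⁿ × ℝ` with its Euclidean norm. -/
abbrev GraphSpace (n : ℕ) : Type := WithLp 2 (EuclideanSpace ℝ (Fin n) × ℝ)

variable {n : ℕ}

/-- In the orthogonal coordinates `(p, t) ↦ Φ (p, t)`, the set `E` is inside `U` the region below
the graph of `g`, up to points of the graph. -/
def IsSubgraphIn (Φ : GraphSpace n ≃ₗᵢ[ℝ] GraphSpace n) (g : EuclideanSpace ℝ (Fin n) → ℝ)
    (U E : Set (GraphSpace n)) : Prop :=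
  ∀ (p : EuclideanSpace ℝ (Fin n)) (t : ℝ), Φ (WithLp.toLp 2 (p, t)) ∈ U →
    (t < g p → Φ (WithLp.toLp 2 (p, t)) ∈ E) ∧ (g p < t → Φ (WithLp.toLp 2 (p, t)) ∉ E)

theorem IsSubgraphIn.inter {Φ : GraphSpace n ≃ₗᵢ[ℝ] GraphSpace n}
    {g : EuclideanSpace ℝ (Fin n) → ℝ} {U E Ω : Set (GraphSpace n)} (h : IsSubgraphIn Φ g U E)
    (hU : U ⊆ Ω) : IsSubgraphIn Φ g U (E ∩ Ω) := fun p t hU' =>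
  ⟨fun ht => ⟨(h p t hU').1 ht, hU hU'⟩, fun ht h' => (h p t hU').2 ht h'.1⟩

/-- The (non normalized) upward normal to the graph of a function of slope `a`. -/
def graphNormal (Φ : GraphSpace n ≃ₗᵢ[ℝ] GraphSpace n) (a : EuclideanSpace ℝ (Fin n) →L[ℝ] ℝ) :
    GraphSpace n :=
  Φ (WithLp.toLp 2 (-(InnerProductSpace.toDual ℝ _).symm a, 1))

theorem inner_graphNormal (Φ : GraphSpace n ≃ₗᵢ[ℝ] GraphSpace n)
    (a : EuclideanSpace ℝ (Fin n) →L[ℝ] ℝ) (q : EuclideanSpace ℝ (Fin n)) (t : ℝ) :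
    inner ℝ (Φ (WithLp.toLp 2 (q, t))) (graphNormal Φ a) = t - a q := by
  rw [graphNormal, LinearIsometryEquiv.inner_map_map, WithLp.prod_inner_apply]
  simp only [inner_neg_right]
  rw [real_inner_comm, InnerProductSpace.toDual_symm_apply]
  simp
  ring

theorem norm_graphNormal (Φ : GraphSpace n ≃ₗᵢ[ℝ] GraphSpace n)
    (a : EuclideanSpace ℝ (Fin n) →L[ℝ] ℝ) : ‖graphNormal Φ a‖ = graphJacobian a := by
  rw [graphNormal, LinearIsometryEquiv.norm_map, WithLp.prod_norm_eq_of_L2, graphJacobian]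
  simp [add_comm]

theorem graphNormal_ne_zero (Φ : GraphSpace n ≃ₗᵢ[ℝ] GraphSpace n)
    (a : EuclideanSpace ℝ (Fin n) →L[ℝ] ℝ) : graphNormal Φ a ≠ 0 := by
  rw [← norm_pos_iff, norm_graphNormal]
  exact graphJacobian_pos a

theorem exists_eq_chart (Φ : GraphSpace n ≃ₗᵢ[ℝ] GraphSpace n) (z : GraphSpace n) :
    ∃ (q : EuclideanSpace ℝ (Fin n)) (t : ℝ), z = Φ (WithLp.toLp 2 (q, t)) :=
  ⟨(Φ.symm z).fst, (Φ.symm z).snd, by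
    conv_lhs => rw [← Φ.apply_symm_apply z]
    rfl⟩

theorem continuous_chart (Φ : GraphSpace n ≃ₗᵢ[ℝ] GraphSpace n) :
    Continuous fun z : EuclideanSpace ℝ (Fin n) × ℝ => Φ (WithLp.toLp 2 z) :=
  Φ.continuous.comp (WithLp.prod_continuous_toLp 2 _ _)

theorem chart_sub_smul (Φ : GraphSpace n ≃ₗᵢ[ℝ] GraphSpace n) (p q : EuclideanSpace ℝ (Fin n))
    (s t r : ℝ) : Φ (WithLp.toLp 2 (p, s)) - r • Φ (WithLp.toLp 2 (q, t)) =
      Φ (WithLp.toLp 2 (p - r • q, s - r * t)) := by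
  rw [← map_smul, ← map_sub]
  rfl

/-- The blow-ups of the subgraphs of `gᵢ` at `(p, gᵢ(p) + rᵢ s)` converge pointwise to a half-space,
away from its boundary. -/
theorem eventually_mem_iff_of_tendsto_slope {ι : Type*} {l : Filter ι}
    {Φ : GraphSpace n ≃ₗᵢ[ℝ] GraphSpace n} {gi : ι → EuclideanSpace ℝ (Fin n) → ℝ}
    {U : Set (GraphSpace n)} (hU : IsOpen U) {E : ι → Set (GraphSpace n)}
    (hE : ∀ᶠ i in l, IsSubgraphIn Φ (gi i) U (E i)) {p : EuclideanSpace ℝ (Fin n)} {y : ℝ}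
    (hp : Φ (WithLp.toLp 2 (p, y)) ∈ U) (hgi : Tendsto (fun i => gi i p) l (𝓝 y))
    {r : ι → ℝ} (hr : Tendsto r l (𝓝 0)) (hr0 : ∀ᶠ i in l, 0 < r i)
    {a : EuclideanSpace ℝ (Fin n) →L[ℝ] ℝ}
    (hslope : ∀ q, Tendsto (fun i => (gi i (p - r i • q) - gi i p) / r i) l (𝓝 (-a q)))
    (s : ℝ) {w : GraphSpace n} (hw : inner ℝ w (graphNormal Φ a) ≠ s) :
    ∀ᶠ i in l, (Φ (WithLp.toLp 2 (p, gi i p + r i * s)) - r i • w ∈ E i ↔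
      s ≤ inner ℝ w (graphNormal Φ a)) := by
  obtain ⟨q, t, rfl⟩ := exists_eq_chart Φ w
  rw [inner_graphNormal] at hw ⊢
  have hmem : ∀ᶠ i in l, Φ (WithLp.toLp 2 (p - r i • q, gi i p + r i * s - r i * t)) ∈ U := by
    have h1 : Tendsto (fun i => (p - r i • q, gi i p + r i * s - r i * t)) l
        (𝓝 (p - (0 : ℝ) • q, y + 0 * s - 0 * t)) :=
      (tendsto_const_nhds.sub (hr.smul_const q)).prodMk_nhds
        ((hgi.add (hr.mul_const s)).sub (hr.mul_const t))
    have h2 := ((continuous_chart Φ).tendsto _).comp h1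
    simp only [zero_smul, sub_zero, zero_mul, add_zero] at h2
    exact h2.eventually (hU.mem_nhds hp)
  -- The rescaled point is below the graph of gᵢ exactly when the difference quotient exceeds s - t;
  -- the limit -a q of these quotients is strictly on one side of s - t.
  rcases hw.lt_or_gt with h | h
  · have h3 : -a q < s - t := by linarith
    filter_upwards [hE, hmem, (hslope q).eventually (gt_mem_nhds h3), hr0] with i hEi hi h4 h5
    rw [chart_sub_smul]
    refine iff_of_false ((hEi _ _ hi).2 ?_) (not_le.2 h)
    rw [div_lt_iff₀ h5] at h4
    linarith
  · have h3 : s - t < -a q := by linarith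
    filter_upwards [hE, hmem, (hslope q).eventually (lt_mem_nhds h3), hr0] with i hEi hi h4 h5
    rw [chart_sub_smul]
    refine iff_of_true ((hEi _ _ hi).1 ?_) h.le
    rw [lt_div_iff₀ h5] at h4
    linarith

theorem tendsto_slope_of_differentiableAt {ι : Type*} {l : Filter ι}
    {g : EuclideanSpace ℝ (Fin n) → ℝ} {p : EuclideanSpace ℝ (Fin n)}
    (hg : DifferentiableAt ℝ g p) {r : ι → ℝ} (hr : Tendsto r l (𝓝 0)) (hr0 : ∀ᶠ i in l, 0 < r i)
    (q : EuclideanSpace ℝ (Fin n)) :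
    Tendsto (fun i => (g (p - r i • q) - g p) / r i) l (𝓝 (-fderiv ℝ g p q)) := by
  have h := (hg.hasFDerivAt.hasLineDerivAt (-q)).tendsto_slope_zero
  have hr' : Tendsto r l (𝓝[≠] 0) := tendsto_nhdsWithin_iff.2 ⟨hr, hr0.mono fun i hi => hi.ne'⟩
  refine (map_neg (fderiv ℝ g p) q ▸ h.comp hr').congr fun i => ?_
  simp [div_eq_inv_mul, sub_eq_add_neg]

/-- At differentiability points of `g`, the subgraph of `g` has the expected outer normal. -/
theorem IsSubgraphIn.isOuterNormal {Φ : GraphSpace n ≃ₗᵢ[ℝ] GraphSpace n}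
    {g : EuclideanSpace ℝ (Fin n) → ℝ} {U E : Set (GraphSpace n)} (h : IsSubgraphIn Φ g U E)
    (hU : IsOpen U) (hE : MeasurableSet E) {p : EuclideanSpace ℝ (Fin n)}
    (hp : Φ (WithLp.toLp 2 (p, g p)) ∈ U) (hg : DifferentiableAt ℝ g p) :
    IsOuterNormal E (Φ (WithLp.toLp 2 (p, g p)))
      ((graphJacobian (fderiv ℝ g p))⁻¹ • graphNormal Φ (fderiv ℝ g p)) := by
  have hJ := graphJacobian_pos (fderiv ℝ g p)
  refine ⟨by rw [norm_smul, norm_graphNormal, norm_inv, Real.norm_of_nonneg hJ.le,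
    inv_mul_cancel₀ hJ.ne'], fun R _ => ?_⟩
  have hset : {y : GraphSpace n | 0 ≤ inner ℝ y
      ((graphJacobian (fderiv ℝ g p))⁻¹ • graphNormal Φ (fderiv ℝ g p))} =
      {y | 0 ≤ inner ℝ y (graphNormal Φ (fderiv ℝ g p))} := by
    ext y
    simp only [mem_ofPred_eq, inner_smul_right]
    exact mul_nonneg_iff_of_pos_left (inv_pos.2 hJ)
  rw [hset]
  have hmeas : MeasurableSet {y : GraphSpace n | 0 ≤ inner ℝ y (graphNormal Φ (fderiv ℝ g p))} :=
    (isClosed_le continuous_const (by fun_prop)).measurableSet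
  have hid : Tendsto (fun r : ℝ => r) (𝓝[>] 0) (𝓝 0) := nhdsWithin_le_nhds
  have hpos : ∀ᶠ r : ℝ in 𝓝[>] 0, 0 < r := self_mem_nhdsWithin
  -- Dominated convergence in a ball: off the boundary hyperplane, which is null, every point
  -- eventually leaves the symmetric difference.
  have key := tendsto_measure_of_ae_tendsto_indicator (μ := (volume : Measure (GraphSpace n)))
    (𝓝[>] (0 : ℝ)) (A := ∅) MeasurableSet.empty
    (As := fun r : ℝ => symmDiff {y : GraphSpace n | Φ (WithLp.toLp 2 (p, g p)) - r • y ∈ E}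
      {y : GraphSpace n | 0 ≤ inner ℝ y (graphNormal Φ (fderiv ℝ g p))} ∩ ball 0 R)
    (fun r => ((hE.preimage (by fun_prop)).symmDiff hmeas).inter measurableSet_ball)
    (B := ball 0 R) measurableSet_ball measure_ball_lt_top.ne
    (Eventually.of_forall fun r => inter_subset_right) ?_
  · simpa using key
  have hnull := volume_setOf_inner_eq (graphNormal_ne_zero Φ (fderiv ℝ g p)) 0
  filter_upwards [compl_mem_ae_iff.2 hnull] with w hw
  filter_upwards [eventually_mem_iff_of_tendsto_slope (gi := fun _ => g) hU
    (E := fun _ => E) (Eventually.of_forall fun _ => h) hp tendsto_const_nhds hid hpos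
    (tendsto_slope_of_differentiableAt hg hid hpos) 0 hw] with r hr
  simp only [mul_zero, add_zero] at hr
  simp [mem_symmDiff, hr]

end GraphChart

/-! ### The nonlocal density and half-space masses. -/

section Kernel

variable {V : Type*} [NormedAddCommGroup V] [InnerProductSpace ℝ V] [FiniteDimensional ℝ V]
  [MeasurableSpace V] [BorelSpace V] {G : V → ℝ} {f : ℝ → ℝ}

theorem IsInteractionKernel.hasCompactSupport (hG : IsInteractionKernel G) :
    HasCompactSupport G := by
  rw [HasCompactSupport, hG.support_eq]
  exact isCompact_closedBall 0 1

theorem IsInteractionKernel.continuous (hG : IsInteractionKernel G) : Continuous G :=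
  hG.smooth.continuous

theorem IsInteractionKernel.integrable (hG : IsInteractionKernel G) : Integrable G :=
  hG.continuous.integrable_of_hasCompactSupport hG.hasCompactSupport

/-- The nonlocal density `G_ε ∗ χ_S` at the point `x`. -/
abbrev kernelAverage (G : V → ℝ) (ε : ℝ) (S : Set V) (x : V) : ℝ :=
  convolution (rescaledKernel G ε) (S.indicator (fun _ => (1 : ℝ)))
    (ContinuousLinearMap.mul ℝ ℝ) volume x

/-- The substitution moves the scale from the kernel to the set: blow-ups of S are integrated
against the fixed integrable function G, which serves as the dominating function. -/
theorem kernelAverage_eq {ε : ℝ} (hε : 0 < ε) (S : Set V) (x : V) :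
    kernelAverage G ε S x = ∫ w, G w * S.indicator (fun _ => (1 : ℝ)) (x - ε • w) := by
  have h := Measure.integral_comp_inv_smul (volume : Measure V)
    (fun w => G w * S.indicator (fun _ => (1 : ℝ)) (x - ε • w)) ε
  have hpow : 0 < ε ^ Module.finrank ℝ V := pow_pos hε _
  simp only [smul_inv_smul₀ hε.ne', abs_of_pos hpow, smul_eq_mul] at h
  simp only [kernelAverage, convolution, rescaledKernel, ContinuousLinearMap.mul_apply', mul_assoc]
  rw [integral_const_mul, h, ← mul_assoc, one_div, inv_mul_cancel₀ hpow.ne', one_mul]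

theorem kernelAverage_nonneg (hG : IsInteractionKernel G) {ε : ℝ} (hε : 0 < ε) (S : Set V) (x : V) :
    0 ≤ kernelAverage G ε S x := by
  rw [kernelAverage_eq hε]
  exact integral_nonneg fun w => mul_nonneg (hG.nonneg w) (indicator_nonneg (fun _ _ => zero_le_one) _)

theorem continuous_kernelAverage (hG : IsInteractionKernel G) {ε : ℝ} (hε : 0 < ε) {S : Set V}
    (hS : MeasurableSet S) : Continuous (kernelAverage G ε S) := by
  refine HasCompactSupport.continuous_convolution_left _ ?_ ?_ ?_
  · have h := hG.hasCompactSupport.comp_smul (inv_ne_zero hε.ne')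
    exact HasCompactSupport.mul_left (f := fun _ => 1 / ε ^ Module.finrank ℝ V) h
  · exact continuous_const.mul (hG.continuous.comp (continuous_const_smul _))
  · exact (locallyIntegrable_const (1 : ℝ)).indicator hS

/-- The mass of `G` in the half-space `{x | s ≤ x · v}`. -/
def halfSpaceMass (G : V → ℝ) (s : ℝ) (v : V) : ℝ :=
  ∫ x in {x : V | s ≤ inner ℝ x v}, G x

theorem measurable_halfSpaceMass (hG : IsInteractionKernel G) :
    Measurable fun z : ℝ × V => halfSpaceMass G z.1 z.2 := by
  have hset : MeasurableSet {z : (ℝ × V) × V | z.1.1 ≤ inner ℝ z.2 z.1.2} :=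
    (isClosed_le (by fun_prop) (by fun_prop)).measurableSet
  have h : StronglyMeasurable
      ({z : (ℝ × V) × V | z.1.1 ≤ inner ℝ z.2 z.1.2}.indicator fun z => G z.2) :=
    ((hG.continuous.comp continuous_snd).measurable.indicator hset).stronglyMeasurable
  convert (h.integral_prod_right' (ν := (volume : Measure V))).measurable using 2 with z
  rw [halfSpaceMass, ← integral_indicator
    (isClosed_le continuous_const (by fun_prop)).measurableSet]
  rfl

theorem ofReal_integral_le_lintegral_ofReal {α : Type*} [MeasurableSpace α] {μ : Measure α}
    (F : α → ℝ) : ENNReal.ofReal (∫ x, F x ∂μ) ≤ ∫⁻ x, ENNReal.ofReal (F x) ∂μ := by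
  by_cases hF : Integrable F μ
  · rw [integral_eq_lintegral_pos_part_sub_lintegral_neg_part hF]
    refine (ENNReal.ofReal_le_ofReal (sub_le_self _ ENNReal.toReal_nonneg)).trans
      ENNReal.ofReal_toReal_le
  · simp [integral_undef hF]

/-- Dividing the normal by J multiplies the threshold by J. Passing to the lower integral needs only
an inequality, so the integrability of the integrand is not an issue. -/
theorem ofReal_surfaceDensity_le (f : ℝ → ℝ) {J : ℝ} (hJ : 0 < J) (v : V) :
    ENNReal.ofReal (surfaceDensity G f (J⁻¹ • v)) ≤
      ∫⁻ t in Ioc (0 : ℝ) 1, ENNReal.ofReal (f (halfSpaceMass G (J * t) v)) := by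
  rw [surfaceDensity, intervalIntegral.integral_of_le zero_le_one]
  refine (ofReal_integral_le_lintegral_ofReal _).trans_eq ?_
  refine lintegral_congr fun t => ?_
  have hset : {x : V | t ≤ inner ℝ x (J⁻¹ • v)} = {x : V | J * t ≤ inner ℝ x v} := by
    ext x
    simp only [mem_ofPred_eq, inner_smul_right]
    rw [← div_eq_inv_mul, le_div_iff₀ hJ, mul_comm]
  rw [halfSpaceMass, hset]

end Kernel

/-! ### The lower estimate in a single chart. -/

section GraphChart

variable {n : ℕ} {G : GraphSpace n → ℝ}

theorem lintegral_eq_ofReal_mul_lintegral_affine (H : ℝ → ℝ≥0∞) {m : ℝ} (hm : 0 < m) (c : ℝ) :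
    ∫⁻ y, H y = ENNReal.ofReal m * ∫⁻ t, H (c + m * t) := by
  have h1 : ∫⁻ t, H (c + m * t) = ENNReal.ofReal m⁻¹ * ∫⁻ y, H y := by
    have h2 : MeasurableEmbedding fun t : ℝ => m * t :=
      (Homeomorph.mulLeft₀ m hm.ne').measurableEmbedding
    rw [← lintegral_add_left_eq_self H c, ← h2.lintegral_map (μ := volume) fun y => H (c + y),
      Real.map_volume_mul_left hm.ne', lintegral_smul_measure, abs_of_pos (inv_pos.2 hm),
      smul_eq_mul]
  rw [h1, ← mul_assoc, ← ENNReal.ofReal_mul hm.le, mul_inv_cancel₀ hm.ne', ENNReal.ofReal_one,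
    one_mul]

theorem lintegral_chart (Φ : GraphSpace n ≃ₗᵢ[ℝ] GraphSpace n) {H : GraphSpace n → ℝ≥0∞}
    (hH : Measurable H) : ∫⁻ z, H z = ∫⁻ p, ∫⁻ y : ℝ, H (Φ (WithLp.toLp 2 (p, y))) := by
  have h : Measurable fun z : EuclideanSpace ℝ (Fin n) × ℝ => H (Φ (WithLp.toLp 2 z)) :=
    hH.comp (continuous_chart Φ).measurable
  rw [← lintegral_prod _ h.aemeasurable, ← Measure.volume_eq_prod,
    ← Φ.measurePreserving.lintegral_comp hH]
  exact ((WithLp.volume_preserving_toLp (EuclideanSpace ℝ (Fin n)) ℝ).lintegral_comp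
    (hH.comp Φ.continuous.measurable)).symm

/-- The nonlocal densities at the points `(p, gᵢ(p) + rᵢ s)` converge to the mass of a half-space. -/
theorem tendsto_kernelAverage (hG : IsInteractionKernel G)
    {Φ : GraphSpace n ≃ₗᵢ[ℝ] GraphSpace n} {gi : ℕ → EuclideanSpace ℝ (Fin n) → ℝ}
    {U : Set (GraphSpace n)} (hU : IsOpen U) {E : ℕ → Set (GraphSpace n)}
    (hEm : ∀ i, MeasurableSet (E i))
    (hE : ∀ᶠ i in atTop, IsSubgraphIn Φ (gi i) U (E i)) {p : EuclideanSpace ℝ (Fin n)} {y : ℝ}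
    (hp : Φ (WithLp.toLp 2 (p, y)) ∈ U) (hgi : Tendsto (fun i => gi i p) atTop (𝓝 y))
    {r : ℕ → ℝ} (hr : Tendsto r atTop (𝓝 0)) (hr0 : ∀ i, 0 < r i)
    {a : EuclideanSpace ℝ (Fin n) →L[ℝ] ℝ}
    (hslope : ∀ q, Tendsto (fun i => (gi i (p - r i • q) - gi i p) / r i) atTop (𝓝 (-a q)))
    (s : ℝ) :
    Tendsto (fun i => kernelAverage G (r i) (E i) (Φ (WithLp.toLp 2 (p, gi i p + r i * s)))) atTop
      (𝓝 (halfSpaceMass G s (graphNormal Φ a))) := by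
  have hset : MeasurableSet {x : GraphSpace n | s ≤ inner ℝ x (graphNormal Φ a)} :=
    (isClosed_le continuous_const (by fun_prop)).measurableSet
  simp only [kernelAverage_eq (hr0 _), halfSpaceMass]
  rw [← integral_indicator hset]
  refine tendsto_integral_of_dominated_convergence G (fun i => ?_) hG.integrable (fun i => ?_) ?_
  · refine (hG.continuous.measurable.mul ?_).aestronglyMeasurable
    exact (measurable_const.indicator (hEm i)).comp
      (continuous_const.sub (continuous_id.const_smul (r i))).measurable
  · refine ae_of_all _ fun w => ?_
    rw [norm_mul, Real.norm_of_nonneg (hG.nonneg w)]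
    refine mul_le_of_le_one_right (hG.nonneg w) ?_
    refine (norm_indicator_le_norm_self _ _).trans ?_
    simp
  · filter_upwards [compl_mem_ae_iff.2
      (volume_setOf_inner_eq (graphNormal_ne_zero Φ a) s)] with w hw
    refine tendsto_const_nhds.congr' ?_
    filter_upwards [eventually_mem_iff_of_tendsto_slope hU hE hp hgi hr
      (Eventually.of_forall hr0) hslope s hw] with i hi
    by_cases h : s ≤ inner ℝ w (graphNormal Φ a)
    · rw [indicator_of_mem (s := {x : GraphSpace n | s ≤ inner ℝ x (graphNormal Φ a)}) h,
        indicator_of_mem (hi.2 h), mul_one]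
    · rw [indicator_of_notMem (s := {x : GraphSpace n | s ≤ inner ℝ x (graphNormal Φ a)}) h,
        indicator_of_notMem (fun h' => h (hi.1 h')), mul_zero]

/-- In the coordinates `Φ` and inside `U`, the sets `E` and `Eₕ` are subgraphs of `g` and `gₕ`, with
`g` Lipschitz and the difference quotients of `gₕ` at scale `εₕ` converging to the derivative
of `g`. -/
structure IsGraphChart (ε : ℕ → ℝ) (E : Set (GraphSpace n)) (Eₕ : ℕ → Set (GraphSpace n))
    (U : Set (GraphSpace n)) (Φ : GraphSpace n ≃ₗᵢ[ℝ] GraphSpace n)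
    (g : EuclideanSpace ℝ (Fin n) → ℝ) (gₕ : ℕ → EuclideanSpace ℝ (Fin n) → ℝ) : Prop where
  isOpen : IsOpen U
  lipschitz : ∃ K, LipschitzWith K g
  measurable : ∀ h, Measurable (gₕ h)
  subgraph : IsSubgraphIn Φ g U E
  subgraph_seq : ∀ᶠ h in atTop, IsSubgraphIn Φ (gₕ h) U (Eₕ h)
  tendsto : ∀ p, Φ (WithLp.toLp 2 (p, g p)) ∈ U → Tendsto (fun h => gₕ h p) atTop (𝓝 (g p))
  tendsto_slope : ∀ p, Φ (WithLp.toLp 2 (p, g p)) ∈ U → DifferentiableAt ℝ g p → ∀ q,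
    Tendsto (fun h => (gₕ h (p - ε h • q) - gₕ h p) / ε h) atTop (𝓝 (-fderiv ℝ g p q))

namespace IsGraphChart

variable {ε : ℕ → ℝ} {E : Set (GraphSpace n)} {Eₕ : ℕ → Set (GraphSpace n)}
  {U : Set (GraphSpace n)} {Φ : GraphSpace n ≃ₗᵢ[ℝ] GraphSpace n}
  {g : EuclideanSpace ℝ (Fin n) → ℝ} {gₕ : ℕ → EuclideanSpace ℝ (Fin n) → ℝ}

theorem mono (hc : IsGraphChart ε E Eₕ U Φ g gₕ) {U' : Set (GraphSpace n)} (hU' : IsOpen U')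
    (hsub : U' ⊆ U) : IsGraphChart ε E Eₕ U' Φ g gₕ where
  isOpen := hU'
  lipschitz := hc.lipschitz
  measurable := hc.measurable
  subgraph := fun p t h => hc.subgraph p t (hsub h)
  subgraph_seq := hc.subgraph_seq.mono fun _ H p t h => H p t (hsub h)
  tendsto := fun p hp => hc.tendsto p (hsub hp)
  tendsto_slope := fun p hp => hc.tendsto_slope p (hsub hp)

end IsGraphChart

/-- The integral defining the surface density of the graph of `g` at `p`. -/
def graphDensity (G : GraphSpace n → ℝ) (f : ℝ → ℝ) (Φ : GraphSpace n ≃ₗᵢ[ℝ] GraphSpace n)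
    (g : EuclideanSpace ℝ (Fin n) → ℝ) (p : EuclideanSpace ℝ (Fin n)) : ℝ≥0∞ :=
  ∫⁻ t in Ioc (0 : ℝ) 1, ENNReal.ofReal
    (f (halfSpaceMass G (graphJacobian (fderiv ℝ g p) * t) (graphNormal Φ (fderiv ℝ g p))))

theorem continuous_graphNormal (Φ : GraphSpace n ≃ₗᵢ[ℝ] GraphSpace n) :
    Continuous (graphNormal Φ) :=
  (continuous_chart Φ).comp
    (((InnerProductSpace.toDual ℝ _).symm.continuous.neg).prodMk continuous_const)

theorem measurable_density_integrand (hG : IsInteractionKernel G) {f : ℝ → ℝ} (hf : Continuous f)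
    (Φ : GraphSpace n ≃ₗᵢ[ℝ] GraphSpace n) (g : EuclideanSpace ℝ (Fin n) → ℝ) :
    Measurable fun z : EuclideanSpace ℝ (Fin n) × ℝ => ENNReal.ofReal
      (f (halfSpaceMass G (graphJacobian (fderiv ℝ g z.1) * z.2)
        (graphNormal Φ (fderiv ℝ g z.1)))) := by
  have h1 : Measurable fun z : EuclideanSpace ℝ (Fin n) × ℝ => fderiv ℝ g z.1 :=
    (measurable_fderiv ℝ g).comp measurable_fst
  have h2 : Measurable fun z : EuclideanSpace ℝ (Fin n) × ℝ =>
      (graphJacobian (fderiv ℝ g z.1) * z.2, graphNormal Φ (fderiv ℝ g z.1)) :=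
    ((continuous_graphJacobian.measurable.comp h1).mul measurable_snd).prodMk
      ((continuous_graphNormal Φ).measurable.comp h1)
  exact ENNReal.measurable_ofReal.comp
    (hf.measurable.comp ((measurable_halfSpaceMass hG).comp h2))

theorem measurable_graphDensity (hG : IsInteractionKernel G) {f : ℝ → ℝ} (hf : Continuous f)
    (Φ : GraphSpace n ≃ₗᵢ[ℝ] GraphSpace n) (g : EuclideanSpace ℝ (Fin n) → ℝ) :
    Measurable (graphDensity G f Φ g) :=
  (measurable_density_integrand hG hf Φ g).lintegral_prod_right'

/-- The lower estimate in a graph chart, in coordinates. -/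
theorem IsGraphChart.lintegral_graphDensity_le_liminf {ε : ℕ → ℝ} {E : Set (GraphSpace n)}
    {Eₕ : ℕ → Set (GraphSpace n)} {U : Set (GraphSpace n)}
    {Φ : GraphSpace n ≃ₗᵢ[ℝ] GraphSpace n} {g : EuclideanSpace ℝ (Fin n) → ℝ}
    {gₕ : ℕ → EuclideanSpace ℝ (Fin n) → ℝ} (hc : IsGraphChart ε E Eₕ U Φ g gₕ)
    (hG : IsInteractionKernel G) {f : ℝ → ℝ} (hf : Continuous f) {Ω : Set (GraphSpace n)}
    (hΩ : MeasurableSet Ω) (hUΩ : U ⊆ Ω) (hEₕ : ∀ h, MeasurableSet (Eₕ h))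
    (hε_pos : ∀ h, 0 < ε h) (hε : Tendsto ε atTop (𝓝 0))
    {ρ : GraphSpace n → ℝ≥0} (hρm : Measurable ρ) (hρ : ContinuousOn ρ U)
    (hρU : ∀ z, ρ z ≠ 0 → z ∈ U) :
    ∫⁻ p, ENNReal.ofReal (graphJacobian (fderiv ℝ g p)) *
        (ρ (Φ (WithLp.toLp 2 (p, g p))) * graphDensity G f Φ g p) ≤
      liminf (fun h => (ENNReal.ofReal (ε h))⁻¹ * ∫⁻ x in (Eₕ h)ᶜ ∩ Ω,
        ρ x * ENNReal.ofReal (f (kernelAverage G (ε h) (Eₕ h ∩ Ω) x))) atTop := by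
  set J : EuclideanSpace ℝ (Fin n) → ℝ := fun p => graphJacobian (fderiv ℝ g p) with hJdef
  have hJ0 : ∀ p, 0 < J p := fun p => graphJacobian_pos _
  have hJm : Measurable J := continuous_graphJacobian.measurable.comp (measurable_fderiv ℝ g)
  set F : ℕ → GraphSpace n → ℝ≥0∞ := fun h x =>
    ρ x * ENNReal.ofReal (f (kernelAverage G (ε h) (Eₕ h ∩ Ω) x)) with hF
  have hFm : ∀ h, Measurable (F h) := fun h =>
    hρm.coe_nnreal_ennreal.mul (ENNReal.measurable_ofReal.comp (hf.measurable.comp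
      (continuous_kernelAverage hG (hε_pos h) ((hEₕ h).inter hΩ)).measurable))
  set H : ℕ → GraphSpace n → ℝ≥0∞ := fun h => ((Eₕ h)ᶜ ∩ Ω).indicator (F h) with hH
  have hset : ∀ h, MeasurableSet ((Eₕ h)ᶜ ∩ Ω) := fun h => (hEₕ h).compl.inter hΩ
  have hHm : ∀ h, Measurable (H h) := fun h => (hFm h).indicator (hset h)
  set Z : ℕ → EuclideanSpace ℝ (Fin n) × ℝ → GraphSpace n := fun h z =>
    Φ (WithLp.toLp 2 (z.1, gₕ h z.1 + ε h * (J z.1 * z.2))) with hZ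
  have hZm : ∀ h, Measurable (Z h) := fun h =>
    (continuous_chart Φ).measurable.comp (measurable_fst.prodMk
      (((hc.measurable h).comp measurable_fst).add
        (measurable_const.mul ((hJm.comp measurable_fst).mul measurable_snd))))
  -- Tonelli in the chart and y = gₕ(p) + εₕ J(p) t: the Jacobian εₕ J cancels the prefactor 1/εₕ.
  -- Dropping t outside (0, 1] only lowers the integral.
  have hk : ∀ h, ∫⁻ z, ENNReal.ofReal (J z.1) * H h (Z h z)
        ∂((volume : Measure (EuclideanSpace ℝ (Fin n))).prod (volume.restrict (Ioc (0 : ℝ) 1))) ≤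
      (ENNReal.ofReal (ε h))⁻¹ * ∫⁻ x in (Eₕ h)ᶜ ∩ Ω, F h x := by
    intro h
    have hm1 : Measurable fun z : EuclideanSpace ℝ (Fin n) × ℝ =>
        ENNReal.ofReal (J z.1) * H h (Z h z) :=
      (ENNReal.measurable_ofReal.comp (hJm.comp measurable_fst)).mul ((hHm h).comp (hZm h))
    rw [lintegral_prod _ hm1.aemeasurable, ← lintegral_indicator (hset h), lintegral_chart Φ (hHm h), ← lintegral_const_mul' _ _ (by simp [hε_pos h])]
    refine lintegral_mono fun p => ?_
    have hεJ : 0 < ε h * J p := mul_pos (hε_pos h) (hJ0 p)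
    rw [lintegral_eq_ofReal_mul_lintegral_affine _ hεJ (gₕ h p), ENNReal.ofReal_mul (hε_pos h).le,
      mul_assoc, ← mul_assoc, ENNReal.inv_mul_cancel (by simp [hε_pos h]) (by simp), one_mul,
      ← lintegral_const_mul' _ _ (by simp)]
    refine (setLIntegral_le_lintegral _ _).trans_eq ?_
    simp only [hZ, mul_assoc]
  refine le_trans ?_ (liminf_le_liminf (Eventually.of_forall hk))
  have hm : ∀ h, Measurable fun z : EuclideanSpace ℝ (Fin n) × ℝ =>
      ENNReal.ofReal (J z.1) * H h (Z h z) := fun h =>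
    (ENNReal.measurable_ofReal.comp (hJm.comp measurable_fst)).mul ((hHm h).comp (hZm h))
  refine le_trans ?_ (lintegral_liminf_le hm)
  rw [lintegral_prod _ (Measurable.liminf hm).aemeasurable]
  obtain ⟨K, hK⟩ := hc.lipschitz
  refine lintegral_mono_ae ?_
  filter_upwards [hK.ae_differentiableAt] with p hp
  rw [graphDensity, ← lintegral_const_mul' _ _ (by simp), ← lintegral_const_mul' _ _ (by simp)]
  refine setLIntegral_mono' measurableSet_Ioc fun t ht => ?_
  by_cases hzero : ρ (Φ (WithLp.toLp 2 (p, g p))) = 0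
  · simp [hzero]
  have hpU := hρU _ hzero
  have hZlim : Tendsto (fun h => Z h (p, t)) atTop (𝓝 (Φ (WithLp.toLp 2 (p, g p)))) := by
    have h1 : Tendsto (fun h => (p, gₕ h p + ε h * (J p * t))) atTop
        (𝓝 (p, g p + 0 * (J p * t))) :=
      tendsto_const_nhds.prodMk_nhds ((hc.tendsto p hpU).add (hε.mul_const _))
    rw [zero_mul, add_zero] at h1
    exact ((continuous_chart Φ).tendsto _).comp h1
  have hFlim : Tendsto (fun h => ENNReal.ofReal (J p) * F h (Z h (p, t))) atTop
      (𝓝 (ENNReal.ofReal (J p) * (ρ (Φ (WithLp.toLp 2 (p, g p))) * ENNReal.ofReal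
        (f (halfSpaceMass G (J p * t) (graphNormal Φ (fderiv ℝ g p))))))) := by
    refine ENNReal.Tendsto.const_mul (ENNReal.Tendsto.mul ?_ (Or.inr (by simp)) ?_
      (Or.inr (by simp))) (Or.inr (by simp))
    · exact ENNReal.tendsto_coe.2 ((hρ.continuousAt (hc.isOpen.mem_nhds hpU)).tendsto.comp hZlim)
    · refine ENNReal.tendsto_ofReal ((hf.tendsto _).comp ?_)
      exact tendsto_kernelAverage hG hc.isOpen (fun i => (hEₕ i).inter hΩ)
        (hc.subgraph_seq.mono fun i hi => hi.inter hUΩ) hpU (hc.tendsto p hpU) hε hε_pos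
        (hc.tendsto_slope p hpU hp) (J p * t)
  -- As t > 0, the point is strictly above the graph, hence eventually in the domain of integration.
  have hHF : (fun h => ENNReal.ofReal (J p) * F h (Z h (p, t))) =ᶠ[atTop]
      fun h => ENNReal.ofReal (J p) * H h (Z h (p, t)) := by
    filter_upwards [hc.subgraph_seq, hZlim.eventually (hc.isOpen.mem_nhds hpU)] with h h1 h2
    have h3 : Z h (p, t) ∉ Eₕ h :=
      (h1 _ _ h2).2 (lt_add_of_pos_right _ (mul_pos (hε_pos h) (mul_pos (hJ0 p) ht.1)))
    have h4 : Z h (p, t) ∈ (Eₕ h)ᶜ ∩ Ω := ⟨h3, hUΩ h2⟩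
    simp only [hH, indicator_of_mem h4]
  rw [(hFlim.congr' hHF).liminf_eq]

end GraphChart

/-! ### Passage from charts to the whole reduced boundary. -/

section Gluing

variable {n : ℕ} {G : GraphSpace n → ℝ}

/-- The parametrization of the graph of `g` in the coordinates `Φ`. -/
def graphParam (Φ : GraphSpace n ≃ₗᵢ[ℝ] GraphSpace n) (g : EuclideanSpace ℝ (Fin n) → ℝ)
    (p : EuclideanSpace ℝ (Fin n)) : GraphSpace n :=
  Φ (WithLp.toLp 2 (p, g p))

theorem dist_graphParam_sq (Φ : GraphSpace n ≃ₗᵢ[ℝ] GraphSpace n)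
    (g : EuclideanSpace ℝ (Fin n) → ℝ) (x y : EuclideanSpace ℝ (Fin n)) :
    dist (graphParam Φ g x) (graphParam Φ g y) ^ 2 = ‖x - y‖ ^ 2 + (g x - g y) ^ 2 := by
  rw [graphParam, graphParam, Φ.dist_map, dist_eq_norm, ← WithLp.toLp_sub,
    WithLp.prod_norm_sq_eq_of_L2]
  simp

/-- The function equal to `graphDensity` on the graph of `g` and to `0` elsewhere. -/
def graphDensityOn (G : GraphSpace n → ℝ) (f : ℝ → ℝ) (Φ : GraphSpace n ≃ₗᵢ[ℝ] GraphSpace n)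
    (g : EuclideanSpace ℝ (Fin n) → ℝ) (z : GraphSpace n) : ℝ≥0∞ :=
  (range (graphParam Φ g)).indicator (fun z => graphDensity G f Φ g (Φ.symm z).fst) z

theorem range_graphParam (Φ : GraphSpace n ≃ₗᵢ[ℝ] GraphSpace n)
    (g : EuclideanSpace ℝ (Fin n) → ℝ) :
    range (graphParam Φ g) = {z | (Φ.symm z).snd = g (Φ.symm z).fst} := by
  ext z
  constructor
  · rintro ⟨p, rfl⟩
    simp [graphParam]
  · intro hz
    obtain ⟨q, t, rfl⟩ := exists_eq_chart Φ z
    simp only [mem_ofPred_eq, LinearIsometryEquiv.symm_apply_apply] at hz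
    exact ⟨q, by rw [graphParam, show g q = t from hz.symm]⟩

theorem measurableSet_range_graphParam (Φ : GraphSpace n ≃ₗᵢ[ℝ] GraphSpace n)
    {g : EuclideanSpace ℝ (Fin n) → ℝ} (hg : Continuous g) :
    MeasurableSet (range (graphParam Φ g)) := by
  rw [range_graphParam]
  refine (isClosed_eq ?_ ?_).measurableSet
  · exact (WithLp.prod_continuous_ofLp 2 _ _).snd.comp Φ.symm.continuous
  · exact hg.comp ((WithLp.prod_continuous_ofLp 2 _ _).fst.comp Φ.symm.continuous)

theorem measurable_graphDensityOn (hG : IsInteractionKernel G) {f : ℝ → ℝ} (hf : Continuous f)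
    (Φ : GraphSpace n ≃ₗᵢ[ℝ] GraphSpace n) {g : EuclideanSpace ℝ (Fin n) → ℝ}
    (hg : Continuous g) : Measurable (graphDensityOn G f Φ g) :=
  ((measurable_graphDensity hG hf Φ g).comp
    ((WithLp.prod_continuous_ofLp 2 _ _).fst.comp Φ.symm.continuous).measurable).indicator
    (measurableSet_range_graphParam Φ hg)

theorem graphDensityOn_graphParam (f : ℝ → ℝ) (Φ : GraphSpace n ≃ₗᵢ[ℝ] GraphSpace n)
    (g : EuclideanSpace ℝ (Fin n) → ℝ) (p : EuclideanSpace ℝ (Fin n)) :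
    graphDensityOn G f Φ g (graphParam Φ g p) = graphDensity G f Φ g p := by
  rw [graphDensityOn, indicator_of_mem (mem_range_self p)]
  simp [graphParam]

namespace IsGraphChart

variable {ε : ℕ → ℝ} {E : Set (GraphSpace n)} {Eₕ : ℕ → Set (GraphSpace n)}
  {U : Set (GraphSpace n)} {Φ : GraphSpace n ≃ₗᵢ[ℝ] GraphSpace n}
  {g : EuclideanSpace ℝ (Fin n) → ℝ} {gₕ : ℕ → EuclideanSpace ℝ (Fin n) → ℝ}

theorem continuous (hc : IsGraphChart ε E Eₕ U Φ g gₕ) : Continuous g := by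
  obtain ⟨K, hK⟩ := hc.lipschitz
  exact hK.continuous

/-- By continuity of g, being strictly below or strictly above the graph is an open condition. -/
theorem frontier_inter_subset (hc : IsGraphChart ε E Eₕ U Φ g gₕ) :
    frontier E ∩ U ⊆ range (graphParam Φ g) := by
  rintro z ⟨hz, hzU⟩
  obtain ⟨q, t, rfl⟩ := exists_eq_chart Φ z
  have hlim : ∀ᶠ z in 𝓝 (Φ (WithLp.toLp 2 (q, t))), z ∈ U := hc.isOpen.mem_nhds hzU
  have hfst : Continuous fun z : GraphSpace n => (Φ.symm z).fst :=
    (WithLp.prod_continuous_ofLp 2 _ _).fst.comp Φ.symm.continuous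
  have hsnd : Continuous fun z : GraphSpace n => (Φ.symm z).snd :=
    (WithLp.prod_continuous_ofLp 2 _ _).snd.comp Φ.symm.continuous
  rcases lt_trichotomy t (g q) with h | h | h
  · refine absurd ?_ hz.2
    rw [mem_interior_iff_mem_nhds]
    have h1 := hsnd.continuousAt.eventually_lt (hc.continuous.comp hfst).continuousAt
      (x₀ := Φ (WithLp.toLp 2 (q, t))) (by simpa using h)
    filter_upwards [hlim, h1] with w hw hw1
    obtain ⟨q', t', rfl⟩ := exists_eq_chart Φ w
    exact (hc.subgraph q' t' hw).1 (by simpa using hw1)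
  · exact ⟨q, by rw [graphParam, h]⟩
  · have hz1 : Φ (WithLp.toLp 2 (q, t)) ∉ interior Eᶜ := by
      rw [interior_compl]
      exact fun h' => h' hz.1
    refine absurd ?_ hz1
    rw [mem_interior_iff_mem_nhds]
    have h1 := (hc.continuous.comp hfst).continuousAt.eventually_lt hsnd.continuousAt
      (x₀ := Φ (WithLp.toLp 2 (q, t))) (by simpa using h)
    filter_upwards [hlim, h1] with w hw hw1
    obtain ⟨q', t', rfl⟩ := exists_eq_chart Φ w
    exact (hc.subgraph q' t' hw).2 (by simpa using hw1)

theorem ae_differentiableAt (hc : IsGraphChart ε E Eₕ U Φ g gₕ) :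
    ∀ᵐ z ∂(μHE[n] : Measure (GraphSpace n)), z ∈ range (graphParam Φ g) →
      ∃ p, z = graphParam Φ g p ∧ DifferentiableAt ℝ g p := by
  obtain ⟨K, hK⟩ := hc.lipschitz
  have hnull := euclideanHausdorffMeasure_image_eq_zero
    (lipschitzWith_of_dist_sq_eq hK (dist_graphParam_sq Φ g)) (ae_iff.1 hK.ae_differentiableAt)
  filter_upwards [compl_mem_ae_iff.2 hnull] with z hz
  rintro ⟨p, rfl⟩
  refine ⟨p, rfl, ?_⟩
  by_contra h
  exact hz ⟨p, h, rfl⟩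

/-- Inside U the reduced boundary is the Borel set of graph points up to a null set, because g is
differentiable at almost all of them. This is what allows almost-everywhere bounds on the restricted
measure. -/
theorem nullMeasurableSet (hc : IsGraphChart ε E Eₕ U Φ g gₕ) (hE : MeasurableSet E) :
    NullMeasurableSet (reducedBoundary E ∩ U) (μHE[n] : Measure (GraphSpace n)) := by
  have hm : MeasurableSet (range (graphParam Φ g) ∩ U) :=
    (measurableSet_range_graphParam Φ hc.continuous).inter hc.isOpen.measurableSet
  refine hm.nullMeasurableSet.congr ?_
  filter_upwards [hc.ae_differentiableAt] with z hz
  refine propext ⟨fun h => ?_, fun h => ⟨hc.frontier_inter_subset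
    ⟨reducedBoundary_subset_frontier E h.1, h.2⟩, h.2⟩⟩
  obtain ⟨p, rfl, hp⟩ := hz h.1
  exact ⟨⟨_, hc.subgraph.isOuterNormal hc.isOpen hE h.2 hp⟩, h.2⟩

theorem ae_ofReal_surfaceDensity_le (hc : IsGraphChart ε E Eₕ U Φ g gₕ) (hE : MeasurableSet E)
    (f : ℝ → ℝ) :
    ∀ᵐ z ∂(μHE[n] : Measure (GraphSpace n)), z ∈ reducedBoundary E ∩ U →
      ENNReal.ofReal (surfaceDensity G f (outerNormal E z)) ≤ graphDensityOn G f Φ g z := by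
  filter_upwards [hc.ae_differentiableAt] with z hz hzU
  obtain ⟨p, rfl, hp⟩ := hz (hc.frontier_inter_subset
    ⟨reducedBoundary_subset_frontier E hzU.1, hzU.2⟩)
  have hν := (hc.subgraph.isOuterNormal hc.isOpen hE hzU.2 hp).outerNormal_eq
  rw [graphDensityOn_graphParam, graphParam, hν]
  exact ofReal_surfaceDensity_le f (graphJacobian_pos _) _

/-- The lower estimate, localized in a graph chart. -/
theorem lintegral_graphDensityOn_le_liminf (hc : IsGraphChart ε E Eₕ U Φ g gₕ)
    (hG : IsInteractionKernel G) {f : ℝ → ℝ} (hf : Continuous f) {Ω : Set (GraphSpace n)}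
    (hΩ : MeasurableSet Ω) (hUΩ : U ⊆ Ω) (hEₕ : ∀ h, MeasurableSet (Eₕ h))
    (hε_pos : ∀ h, 0 < ε h) (hε : Tendsto ε atTop (𝓝 0))
    {ρ : GraphSpace n → ℝ≥0} (hρm : Measurable ρ) (hρ : ContinuousOn ρ U)
    (hρU : ∀ z, ρ z ≠ 0 → z ∈ U) :
    ∫⁻ z, ρ z * graphDensityOn G f Φ g z ∂(μHE[n] : Measure (GraphSpace n)) ≤
      liminf (fun h => (ENNReal.ofReal (ε h))⁻¹ * ∫⁻ x in (Eₕ h)ᶜ ∩ Ω,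
        ρ x * ENNReal.ofReal (f (kernelAverage G (ε h) (Eₕ h ∩ Ω) x))) atTop := by
  refine le_trans ?_ (hc.lintegral_graphDensity_le_liminf hG hf hΩ hUΩ hEₕ hε_pos hε hρm hρ hρU)
  obtain ⟨K, hK⟩ := hc.lipschitz
  have hm : Measurable fun z => (ρ z : ℝ≥0∞) * graphDensityOn G f Φ g z :=
    hρm.coe_nnreal_ennreal.mul (measurable_graphDensityOn hG hf Φ hc.continuous)
  have h := setLIntegral_range_le_lintegral_graph hK (dist_graphParam_sq Φ g) hm
  simp only [graphDensityOn_graphParam] at h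
  refine le_trans (le_of_eq ?_) h
  rw [← lintegral_indicator (measurableSet_range_graphParam Φ hc.continuous)]
  refine lintegral_congr fun z => ?_
  by_cases hz : z ∈ range (graphParam Φ g)
  · rw [indicator_of_mem hz]
  · rw [indicator_of_notMem hz, graphDensityOn, indicator_of_notMem hz, mul_zero]

end IsGraphChart

/-- Fatou's lemma for the counting measure. -/
theorem tsum_liminf_le_liminf_tsum {ι : Type*} [Countable ι] (a : ι → ℕ → ℝ≥0∞) :
    ∑' i, liminf (a i) atTop ≤ liminf (fun h => ∑' i, a i h) atTop := by
  let _ : MeasurableSpace ι := ⊤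
  have := lintegral_liminf_le (μ := (Measure.count : Measure ι)) (u := atTop)
    (f := fun h i => a i h) fun h => measurable_from_top
  simpa [lintegral_count] using this

/-- A countable family of open sets carries a partition of unity on its union, made of functions
which are continuous there and do not vanish only inside the open sets. -/
theorem exists_partition_of_unity_of_countable {V : Type*} [NormedAddCommGroup V]
    [NormedSpace ℝ V] [FiniteDimensional ℝ V] [MeasurableSpace V] [BorelSpace V]
    {ι : Type*} [Countable ι] {U : ι → Set V} (hU : ∀ i, IsOpen (U i)) :
    ∃ ρ : ι → V → ℝ≥0, (∀ i, Measurable (ρ i)) ∧ (∀ i, ContinuousOn (ρ i) (⋃ j, U j)) ∧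
      (∀ i z, ρ i z ≠ 0 → z ∈ U i) ∧ (∀ z ∈ ⋃ j, U j, ∑' i, (ρ i z : ℝ≥0∞) = 1) ∧
      ∀ z, ∑' i, (ρ i z : ℝ≥0∞) ≤ 1 := by
  choose d hd_supp hd_smooth hd_range using fun i => (hU i).exists_contDiff_support_eq
    (n := (⊤ : ℕ∞))
  -- Summable weights make the sum D of the bumps converge uniformly, so D is continuous without
  -- local finiteness. It is positive on the union; elsewhere it vanishes and 0 / 0 = 0.
  obtain ⟨w, hw_pos, W, hw_sum, -⟩ := NNReal.exists_pos_sum_of_countable (one_ne_zero) ι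
  set e : ι → V → ℝ≥0 := fun i z => w i * (d i z).toNNReal with he
  have hdc : ∀ i, Continuous (d i) := fun i => (hd_smooth i).continuous
  have hec : ∀ i, Continuous (e i) := fun i =>
    continuous_const.mul (continuous_real_toNNReal.comp (hdc i))
  have hdle : ∀ i z, (d i z).toNNReal ≤ 1 := fun i z => by
    have := (hd_range i (mem_range_self z)).2
    simpa using this
  have hele : ∀ i z, e i z ≤ w i := fun i z => mul_le_of_le_one_right' (hdle i z)
  have hsum : ∀ z, Summable fun i => e i z := fun z =>
    NNReal.summable_of_le (fun i => hele i z) hw_sum.summable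
  set D : V → ℝ≥0 := fun z => ∑' i, e i z with hD
  have hDc : Continuous D := by
    refine continuous_induced_rng.2 ?_
    have h1 : (NNReal.toReal ∘ D) = fun z => ∑' i, (e i z : ℝ) := by
      ext z
      simp [hD, NNReal.coe_tsum]
    change Continuous (NNReal.toReal ∘ D)
    rw [h1]
    refine continuous_tsum (fun i => NNReal.continuous_coe.comp (hec i))
      (NNReal.summable_coe.2 hw_sum.summable) fun i z => ?_
    rw [Real.norm_of_nonneg (NNReal.coe_nonneg _)]
    exact_mod_cast hele i z
  have hpos : ∀ i z, e i z ≠ 0 → z ∈ U i := fun i z hz => by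
    rw [← hd_supp i, Function.mem_support]
    intro h0
    simp [he, h0] at hz
  have hDpos : ∀ z ∈ ⋃ j, U j, D z ≠ 0 := by
    intro z hz
    obtain ⟨i, hi⟩ := mem_iUnion.1 hz
    have h1 : d i z ≠ 0 := by rwa [← Function.mem_support, hd_supp i]
    have h2 : 0 < d i z := lt_of_le_of_ne (hd_range i (mem_range_self z)).1 h1.symm
    have h3 : 0 < e i z := mul_pos (hw_pos i) (Real.toNNReal_pos.2 h2)
    exact (h3.trans_le ((hsum z).le_tsum i fun _ _ => zero_le)).ne'
  have htsum : ∀ z, ∑' i, ((e i z / D z : ℝ≥0) : ℝ≥0∞) = ((D z / D z : ℝ≥0) : ℝ≥0∞) := by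
    intro z
    have h1 : HasSum (fun i => e i z / D z) (D z / D z) := (hsum z).hasSum.div_const _
    exact (ENNReal.hasSum_coe.2 h1).tsum_eq
  refine ⟨fun i z => e i z / D z, fun i => (hec i).measurable.div hDc.measurable,
    fun i => (hec i).continuousOn.div hDc.continuousOn hDpos,
    fun i z hz => hpos i z fun h => hz (by simp [h]), fun z hz => ?_, fun z => ?_⟩
  · rw [htsum, div_self (hDpos z hz), ENNReal.coe_one]
  · rw [htsum]
    exact_mod_cast div_self_le_one (D z)

/-- The lower estimate holds as soon as almost all points of the reduced boundary lie in a graph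
chart. -/
theorem anisotropicPerimeter_le_liminf_of_charts (hG : IsInteractionKernel G) {f : ℝ → ℝ}
    (hf : Continuous f) {Ω : Set (GraphSpace n)} (hΩ : IsOpen Ω) {E : Set (GraphSpace n)}
    (hE : MeasurableSet E) {Eₕ : ℕ → Set (GraphSpace n)} (hEₕ : ∀ h, MeasurableSet (Eₕ h))
    {ε : ℕ → ℝ} (hε_pos : ∀ h, 0 < ε h) (hε : Tendsto ε atTop (𝓝 0))
    {N : Set (GraphSpace n)} (hN : (μHE[n] : Measure (GraphSpace n)) N = 0)
    (hloc : ∀ z ∈ reducedBoundary E \ N, ∃ U Φ g gₕ, z ∈ U ∧ IsGraphChart ε E Eₕ U Φ g gₕ) :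
    anisotropicPerimeter G f Ω E ≤
      liminf (fun h => nonlocalEnergy G f Ω (ε h) (Eₕ h)) atTop := by
  choose! U Φ g gₕ hzU hc using hloc
  set S : Set (GraphSpace n) := (reducedBoundary E ∩ Ω) \ N
  -- Lindelöf: countably many charts, cut down to Ω, suffice.
  obtain ⟨T, hTc, hTU⟩ := TopologicalSpace.isOpen_iUnion_countable (fun z : S => U z ∩ Ω)
    fun z => (hc z ⟨z.2.1.1, z.2.2⟩).isOpen.inter hΩ
  have : Countable T := hTc.to_subtype
  have hchart : ∀ i : T, IsGraphChart ε E Eₕ (U i ∩ Ω) (Φ i) (g i) (gₕ i) := fun i =>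
    have h := hc i ⟨i.1.2.1.1, i.1.2.2⟩
    h.mono (h.isOpen.inter hΩ) inter_subset_left
  obtain ⟨ρ, hρm, hρc, hρU, hρ1, hρle⟩ :=
    exists_partition_of_unity_of_countable fun i : T => (hchart i).isOpen
  have hScover : S ⊆ ⋃ i : T, U i ∩ Ω := by
    intro z hz
    have h1 : z ∈ ⋃ z : S, U z ∩ Ω := mem_iUnion.2 ⟨⟨z, hz⟩, hzU z ⟨hz.1.1, hz.2⟩, hz.1.2⟩
    rw [← hTU] at h1
    obtain ⟨i, hi, hzi⟩ := mem_iUnion₂.1 h1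
    exact mem_iUnion.2 ⟨⟨i, hi⟩, hzi⟩
  have hnull : NullMeasurableSet (reducedBoundary E ∩ Ω)
      (μHE[n] : Measure (GraphSpace n)) := by
    have h1 : NullMeasurableSet (⋃ i : T, reducedBoundary E ∩ (U i ∩ Ω))
        (μHE[n] : Measure (GraphSpace n)) :=
      NullMeasurableSet.iUnion fun i => (hchart i).nullMeasurableSet hE
    refine h1.congr ?_
    filter_upwards [compl_mem_ae_iff.2 hN] with z hz
    refine propext ⟨fun h => ?_, fun h => ?_⟩
    · obtain ⟨i, hi⟩ := mem_iUnion.1 h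
      exact ⟨hi.1, hi.2.2⟩
    · obtain ⟨i, hi⟩ := mem_iUnion.1 (hScover ⟨h, hz⟩)
      exact mem_iUnion.2 ⟨i, h.1, hi⟩
  have hdim : Module.finrank ℝ (GraphSpace n) - 1 = n := by
    rw [(WithLp.linearEquiv 2 ℝ (EuclideanSpace ℝ (Fin n) × ℝ)).finrank_eq]
    simp
  have hκm : ∀ i : T, Measurable (graphDensityOn G f (Φ i) (g i)) := fun i =>
    measurable_graphDensityOn hG hf _ (hchart i).continuous
  calc anisotropicPerimeter G f Ω E
      = ∫⁻ z in reducedBoundary E ∩ Ω,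
          ENNReal.ofReal (surfaceDensity G f (outerNormal E z)) ∂(μHE[n]) := by
        rw [anisotropicPerimeter, hdim]
    _ ≤ ∫⁻ z in reducedBoundary E ∩ Ω,
          ∑' i : T, ρ i z * graphDensityOn G f (Φ i) (g i) z ∂(μHE[n]) := by
        refine lintegral_mono_ae ((ae_restrict_iff'₀ hnull).2 ?_)
        filter_upwards [compl_mem_ae_iff.2 hN,
          ae_all_iff.2 fun i : T => (hchart i).ae_ofReal_surfaceDensity_le (G := G) hE f]
          with z hz hdens hzS
        calc ENNReal.ofReal (surfaceDensity G f (outerNormal E z))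
            = ∑' i : T, ρ i z * ENNReal.ofReal (surfaceDensity G f (outerNormal E z)) := by
              rw [ENNReal.tsum_mul_right, hρ1 z (hScover ⟨hzS, hz⟩), one_mul]
          _ ≤ _ := by
              -- The i-th density bound holds only inside the i-th chart, which is where ρ i can be
              -- nonzero.
              refine ENNReal.tsum_le_tsum fun i => ?_
              by_cases h0 : ρ i z = 0
              · simp [h0]
              · gcongr
                exact hdens i ⟨hzS.1, hρU i z h0⟩
    _ ≤ ∫⁻ z, ∑' i : T, ρ i z * graphDensityOn G f (Φ i) (g i) z ∂(μHE[n]) :=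
        setLIntegral_le_lintegral _ _
    _ = ∑' i : T, ∫⁻ z, ρ i z * graphDensityOn G f (Φ i) (g i) z ∂(μHE[n]) :=
        lintegral_tsum fun i => ((hρm i).coe_nnreal_ennreal.mul (hκm i)).aemeasurable
    _ ≤ ∑' i : T, liminf (fun h => (ENNReal.ofReal (ε h))⁻¹ * ∫⁻ x in (Eₕ h)ᶜ ∩ Ω,
          ρ i x * ENNReal.ofReal (f (kernelAverage G (ε h) (Eₕ h ∩ Ω) x))) atTop :=
        ENNReal.tsum_le_tsum fun i => (hchart i).lintegral_graphDensityOn_le_liminf hG hf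
          hΩ.measurableSet inter_subset_right hEₕ hε_pos hε (hρm i)
          ((hρc i).mono (subset_iUnion (fun i : T => U i ∩ Ω) i)) (hρU i)
    _ ≤ liminf (fun h => ∑' i : T, (ENNReal.ofReal (ε h))⁻¹ * ∫⁻ x in (Eₕ h)ᶜ ∩ Ω,
          ρ i x * ENNReal.ofReal (f (kernelAverage G (ε h) (Eₕ h ∩ Ω) x))) atTop :=
        tsum_liminf_le_liminf_tsum _
    _ ≤ _ := by
        refine liminf_le_liminf (Eventually.of_forall fun h => ?_)
        have hFm : Measurable fun x =>
            ENNReal.ofReal (f (kernelAverage G (ε h) (Eₕ h ∩ Ω) x)) :=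
          ENNReal.measurable_ofReal.comp (hf.measurable.comp
            (continuous_kernelAverage hG (hε_pos h) ((hEₕ h).inter hΩ.measurableSet)).measurable)
        have hm : ∀ i : T, Measurable fun x => (ρ i x : ℝ≥0∞) *
            ENNReal.ofReal (f (kernelAverage G (ε h) (Eₕ h ∩ Ω) x)) := fun i =>
          (hρm i).coe_nnreal_ennreal.mul hFm
        rw [ENNReal.tsum_mul_left, ← lintegral_tsum fun i => (hm i).aemeasurable, nonlocalEnergy]
        gcongr with x
        rw [ENNReal.tsum_mul_right]
        exact mul_le_of_le_one_left' (hρle x)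

end Gluing

/-! ### Charts at the bottom, on the lateral wall and at the top. -/

section Charts

variable {n : ℕ}

theorem continuous_graphSpace_fst : Continuous fun z : GraphSpace n => z.fst :=
  (WithLp.prod_continuous_ofLp 2 _ _).fst

theorem continuous_graphSpace_snd : Continuous fun z : GraphSpace n => z.snd :=
  (WithLp.prod_continuous_ofLp 2 _ _).snd

theorem measurable_piecewise_zero {D : Set (EuclideanSpace ℝ (Fin n))}
    [∀ x, Decidable (x ∈ D)] (hD : IsOpen D)
    {u : EuclideanSpace ℝ (Fin n) → ℝ} (hu : ContinuousOn u D) : Measurable (D.piecewise u 0) :=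
  hu.measurable_piecewise continuousOn_const hD.measurableSet

/-- Nothing is known about u off D, so it is first replaced there by 0 to obtain a measurable
function. -/
theorem measurableSet_subgraphOver {D : Set (EuclideanSpace ℝ (Fin n))} (hD : IsOpen D)
    {u : EuclideanSpace ℝ (Fin n) → ℝ} (hu : ContinuousOn u D) :
    MeasurableSet (subgraphOver D u) := by
  classical
  have hv := measurable_piecewise_zero hD hu
  have heq : subgraphOver D u = (fun z : GraphSpace n => z.fst) ⁻¹' D ∩
      ({z | 0 ≤ z.snd} ∩ {z | z.snd ≤ D.piecewise u 0 z.fst}) := by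
    ext z
    refine and_congr_right fun hz => and_congr_right fun _ => ?_
    have : z.fst ∈ D := hz
    simp [this]
  rw [heq]
  refine (continuous_graphSpace_fst.measurable hD.measurableSet).inter (MeasurableSet.inter ?_ ?_)
  · exact measurableSet_le measurable_const continuous_graphSpace_snd.measurable
  · exact measurableSet_le continuous_graphSpace_snd.measurable
      (hv.comp continuous_graphSpace_fst.measurable)

/-- Any unit vector can be taken as the vertical direction of orthogonal coordinates. -/
theorem exists_linearIsometryEquiv_apply_eq {e : GraphSpace n} (he : ‖e‖ = 1) :
    ∃ Φ : GraphSpace n ≃ₗᵢ[ℝ] GraphSpace n, Φ (WithLp.toLp 2 (0, 1)) = e := by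
  refine ⟨(ℝ ∙ (WithLp.toLp 2 ((0 : EuclideanSpace ℝ (Fin n)), (1 : ℝ)) - e))ᗮ.reflection,
    Submodule.reflection_sub ?_⟩
  rw [he, WithLp.prod_norm_eq_of_L2]
  simp

theorem chart_eq_add (Φ : GraphSpace n ≃ₗᵢ[ℝ] GraphSpace n) (q : EuclideanSpace ℝ (Fin n)) (t : ℝ) :
    Φ (WithLp.toLp 2 (q, t)) =
      Φ (WithLp.toLp 2 (q, 0)) + t • Φ (WithLp.toLp 2 (0, 1)) := by
  rw [← map_smul, ← map_add]
  congr 1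
  simp [← WithLp.toLp_smul, ← WithLp.toLp_add]

theorem inner_chart (Φ : GraphSpace n ≃ₗᵢ[ℝ] GraphSpace n) (q : EuclideanSpace ℝ (Fin n)) (t : ℝ) :
    inner ℝ (Φ (WithLp.toLp 2 (q, t))) (Φ (WithLp.toLp 2 (0, 1))) = t := by
  rw [Φ.inner_map_map, WithLp.prod_inner_apply]
  simp

theorem lipschitzWith_comp_chart_fst {K : ℝ≥0} {g : EuclideanSpace ℝ (Fin n) → ℝ}
    (hg : LipschitzWith K g) (Φ : GraphSpace n ≃ₗᵢ[ℝ] GraphSpace n) :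
    LipschitzWith K fun q => g (Φ (WithLp.toLp 2 (q, 0))).fst := by
  refine LipschitzWith.of_dist_le_mul fun p q => ?_
  refine (hg.dist_le_mul _ _).trans ?_
  gcongr
  rw [dist_eq_norm, dist_eq_norm, ← WithLp.sub_fst, ← map_sub, ← WithLp.toLp_sub]
  refine (WithLp.norm_fst_le _ _).trans_eq ?_
  rw [Φ.norm_map, WithLp.prod_norm_eq_of_L2]
  simp

variable {D : Set (EuclideanSpace ℝ (Fin n))} {u : EuclideanSpace ℝ (Fin n) → ℝ}
  {uₕ : ℕ → EuclideanSpace ℝ (Fin n) → ℝ} {ε : ℕ → ℝ}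

/-- Near a point of `D × {0}`, the sets are half-spaces. -/
theorem exists_isGraphChart_bottom (hD : IsOpen D) (hu : ContinuousOn u D)
    (hconv : TendstoUniformlyOn uₕ u atTop D) (hε : Tendsto ε atTop (𝓝 0))
    (hε_pos : ∀ h, 0 < ε h) {z : GraphSpace n} (hz : z.fst ∈ D) (hz0 : z.snd = 0)
    (hpos : 0 < u z.fst) :
    ∃ U Φ g gₕ, z ∈ U ∧
      IsGraphChart ε (subgraphOver D u) (fun h => subgraphOver D (uₕ h)) U Φ g gₕ := by
  -- With the axis pointing downwards, the set lies below the graph of 0.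
  obtain ⟨Φ, hΦ⟩ := exists_linearIsometryEquiv_apply_eq
    (e := WithLp.toLp 2 ((0 : EuclideanSpace ℝ (Fin n)), (-1 : ℝ)))
    (by rw [WithLp.prod_norm_eq_of_L2]; simp)
  have hsnd : ∀ q t, (Φ (WithLp.toLp 2 (q, t))).snd = -t := by
    intro q t
    have h := inner_chart Φ q t
    rw [hΦ, WithLp.prod_inner_apply] at h
    simp at h
    linarith
  -- In the window y < c and u > 2c; once |uₕ - u| < c, the upper constraint y ≤ uₕ holds
  -- automatically.
  set c := u z.fst / 3
  have hc : 0 < c := by positivity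
  have hev : ∀ᶠ x in 𝓝 z.fst, x ∈ D ∧ 2 * c < u x := by
    have h1 : ∀ᶠ x in 𝓝 z.fst, 2 * c < u x :=
      (hu.continuousAt (hD.mem_nhds hz)).eventually (lt_mem_nhds (by simp only [c]; linarith))
    filter_upwards [hD.mem_nhds hz, h1] with x hx hx'
    exact ⟨hx, hx'⟩
  obtain ⟨r, hr, hball⟩ := Metric.eventually_nhds_iff_ball.1 hev
  refine ⟨{w | w.fst ∈ ball z.fst r ∧ w.snd < c}, Φ, fun _ => 0, fun _ _ => 0,
    ⟨mem_ball_self hr, by rwa [hz0]⟩, ?_⟩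
  constructor
  · exact (isOpen_ball.preimage continuous_graphSpace_fst).inter
      (isOpen_lt continuous_graphSpace_snd continuous_const)
  · exact ⟨0, LipschitzWith.const 0⟩
  · exact fun _ => measurable_const
  · rintro p t ⟨h1, h2⟩
    rw [hsnd] at h2
    obtain ⟨h3, h4⟩ := hball _ h1
    refine ⟨fun ht => ⟨h3, ?_, ?_⟩, fun ht h => ?_⟩
    · rw [hsnd]; linarith
    · rw [hsnd]; linarith
    · have := h.2.1
      rw [hsnd] at this
      linarith
  · filter_upwards [Metric.tendstoUniformlyOn_iff.1 hconv c hc] with h hh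
    rintro p t ⟨h1, h2⟩
    rw [hsnd] at h2
    obtain ⟨h3, h4⟩ := hball _ h1
    have h5 := abs_lt.1 (Real.dist_eq _ _ ▸ hh _ h3)
    refine ⟨fun ht => ⟨h3, ?_, ?_⟩, fun ht h => ?_⟩
    · rw [hsnd]; linarith
    · rw [hsnd]; linarith [h5.2]
    · have := h.2.1
      rw [hsnd] at this
      linarith
  · exact fun p _ => tendsto_const_nhds
  · intro p _ hp q
    exact tendsto_slope_of_differentiableAt hp hε (Eventually.of_forall hε_pos) q

/-- Near a point `(x, y)` with `x` in the closure of a Lipschitz domain `D` and `0 < y < u(x)`, the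
sets are all equal to the cylinder over `D`. Here `v` is an extension of `u`. -/
theorem exists_isGraphChart_lateral (hconv : TendstoUniformlyOn uₕ u atTop D)
    (hε : Tendsto ε atTop (𝓝 0)) (hε_pos : ∀ h, 0 < ε h)
    {x₀ : EuclideanSpace ℝ (Fin n)} {r : ℝ} {K : ℝ≥0} {g : EuclideanSpace ℝ (Fin n) → ℝ}
    (hg : LipschitzWith K g) {e : EuclideanSpace ℝ (Fin n)}
    (hDg : ∀ x ∈ ball x₀ r, (x ∈ D ↔ inner ℝ x e < g (x - (inner ℝ x e : ℝ) • e)))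
    {v : EuclideanSpace ℝ (Fin n) → ℝ} (hv : Continuous v) (huv : EqOn u v (D ∩ ball x₀ r))
    {Φ : GraphSpace n ≃ₗᵢ[ℝ] GraphSpace n}
    (hΦ : Φ (WithLp.toLp 2 (0, 1)) = WithLp.toLp 2 (e, 0))
    {z : GraphSpace n} (hz : z.fst ∈ ball x₀ r) (hz0 : 0 < z.snd) (hz1 : z.snd < v z.fst) :
    ∃ U g gₕ, z ∈ U ∧
      IsGraphChart ε (subgraphOver D u) (fun h => subgraphOver D (uₕ h)) U Φ g gₕ := by
  set g' : EuclideanSpace ℝ (Fin n) → ℝ := fun q => g (Φ (WithLp.toLp 2 (q, 0))).fst with hg'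
  have hlip : LipschitzWith K g' := lipschitzWith_comp_chart_fst hg Φ
  have hmem : ∀ p t, (Φ (WithLp.toLp 2 (p, t))).fst ∈ ball x₀ r →
      ((Φ (WithLp.toLp 2 (p, t))).fst ∈ D ↔ t < g' p) := by
    intro p t h
    have h1 : inner ℝ (Φ (WithLp.toLp 2 (p, t))).fst e = t := by
      have := inner_chart Φ p t
      rw [hΦ, WithLp.prod_inner_apply] at this
      simpa using this
    rw [hDg _ h, h1, hg']
    have h2 : (Φ (WithLp.toLp 2 (p, t))).fst - t • e = (Φ (WithLp.toLp 2 (p, 0))).fst := by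
      rw [chart_eq_add Φ p t, hΦ]
      simp
    rw [h2]
  -- The window keeps y a distance m below v, which exceeds the eventual error |uₕ - u| < m; only
  -- membership in D then matters.
  set m := (v z.fst - z.snd) / 3 with hm
  have hm0 : 0 < m := by rw [hm]; linarith
  refine ⟨{w | w.fst ∈ ball x₀ r ∧ 0 < w.snd ∧ w.snd < z.snd + m ∧ z.snd + 2 * m < v w.fst},
    g', fun _ => g', ⟨hz, hz0, by linarith, by linarith⟩, ?_⟩
  constructor
  · refine (isOpen_ball.preimage continuous_graphSpace_fst).inter
      ((isOpen_lt continuous_const continuous_graphSpace_snd).inter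
      ((isOpen_lt continuous_graphSpace_snd continuous_const).inter
      (isOpen_lt continuous_const (hv.comp continuous_graphSpace_fst))))
  · exact ⟨K, hlip⟩
  · exact fun _ => hlip.continuous.measurable
  · rintro p t ⟨h1, h2, h3, h4⟩
    refine ⟨fun ht => ?_, fun ht h => ?_⟩
    · have h5 := (hmem p t h1).2 ht
      refine ⟨h5, h2.le, ?_⟩
      rw [huv ⟨h5, h1⟩]
      linarith
    · exact ht.not_gt ((hmem p t h1).1 h.1)
  · filter_upwards [Metric.tendstoUniformlyOn_iff.1 hconv m hm0] with h hh
    rintro p t ⟨h1, h2, h3, h4⟩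
    refine ⟨fun ht => ?_, fun ht h => ?_⟩
    · have h5 := (hmem p t h1).2 ht
      have h6 := abs_lt.1 (Real.dist_eq _ _ ▸ hh _ h5)
      rw [huv ⟨h5, h1⟩] at h6
      exact ⟨h5, h2.le, by linarith [h6.2]⟩
    · exact ht.not_gt ((hmem p t h1).1 h.1)
  · exact fun p _ => tendsto_const_nhds
  · intro p _ hp q
    exact tendsto_slope_of_differentiableAt hp hε (Eventually.of_forall hε_pos) q

/-- Under uniform convergence of the derivatives, the difference quotients of `uₕ` at a vanishing
scale converge to the derivative of the limit. -/
theorem tendsto_slope_of_tendstoInC1On (hu : ContDiffOn ℝ 1 u D) (hD : IsOpen D)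
    (huₕ : ∀ h, ContDiffOn ℝ 1 (uₕ h) D) (hconv : TendstoInC1On uₕ u D)
    (hε : Tendsto ε atTop (𝓝 0)) (hε_pos : ∀ h, 0 < ε h) {p : EuclideanSpace ℝ (Fin n)}
    (hp : p ∈ D) (q : EuclideanSpace ℝ (Fin n)) :
    Tendsto (fun h => (uₕ h (p - ε h • q) - uₕ h p) / ε h) atTop (𝓝 (-fderiv ℝ u p q)) := by
  have hdiff : ∀ {w : EuclideanSpace ℝ (Fin n) → ℝ}, ContDiffOn ℝ 1 w D → ∀ x ∈ D,
      DifferentiableAt ℝ w x := fun hw x hx =>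
    (hw.differentiableOn (by norm_num)).differentiableAt (hD.mem_nhds hx)
  obtain ⟨r, hr, hball⟩ := Metric.isOpen_iff.1 hD p hp
  have h1 := tendsto_slope_of_differentiableAt (hdiff hu p hp) hε (Eventually.of_forall hε_pos) q
  -- The mean value inequality bounds this quotient by ‖q‖ sup ‖∇uₕ - ∇u‖, whatever the scale. The +
  -- 1 below covers q = 0.
  have h2 : Tendsto (fun h => ((uₕ h - u) (p - ε h • q) - (uₕ h - u) p) / ε h) atTop (𝓝 0) := by
    rw [Metric.tendsto_nhds]
    intro η hη
    have hη' : 0 < η / (‖q‖ + 1) := by positivity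
    have h3 : Tendsto (fun h => p - ε h • q) atTop (𝓝 p) := by
      have := (tendsto_const_nhds (x := p)).sub (hε.smul_const q)
      simpa using this
    filter_upwards [Metric.tendstoUniformlyOn_iff.1 hconv.2 _ hη',
      h3.eventually (ball_mem_nhds p hr)] with h hh hmem
    have h4 := (convex_ball p r).norm_image_sub_le_of_norm_fderiv_le (𝕜 := ℝ)
      (f := uₕ h - u) (C := η / (‖q‖ + 1))
      (fun x hx => (hdiff (huₕ h) x (hball hx)).sub (hdiff hu x (hball hx)))
      (fun x hx => by
        rw [fderiv_sub (hdiff (huₕ h) x (hball hx)) (hdiff hu x (hball hx)), ← dist_eq_norm,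
          dist_comm]
        exact (hh x (hball hx)).le) (mem_ball_self hr) hmem
    rw [sub_sub_cancel_left, norm_neg, norm_smul, Real.norm_of_nonneg (hε_pos h).le] at h4
    rw [dist_zero_right, norm_div, Real.norm_of_nonneg (hε_pos h).le, div_lt_iff₀ (hε_pos h)]
    refine h4.trans_lt ?_
    rw [div_mul_eq_mul_div, div_lt_iff₀ (by positivity)]
    nlinarith [mul_pos hη (hε_pos h), norm_nonneg q]
  have h5 := h1.add h2
  rw [add_zero] at h5
  refine h5.congr fun h => ?_
  simp only [Pi.sub_apply]
  ring

/-- Near a point of the graph of `u` over `D`, the sets are subgraphs. -/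
theorem exists_isGraphChart_top (hD : IsOpen D) (hu : IsC11On u D) (huₕ : ∀ h, IsC11On (uₕ h) D)
    (hconv : TendstoInC1On uₕ u D) (hε : Tendsto ε atTop (𝓝 0))
    (hε_pos : ∀ h, 0 < ε h) {z : GraphSpace n} (hz : z.fst ∈ D) (hz1 : z.snd = u z.fst)
    (hpos : 0 < u z.fst) :
    ∃ U Φ g gₕ, z ∈ U ∧
      IsGraphChart ε (subgraphOver D u) (fun h => subgraphOver D (uₕ h)) U Φ g gₕ := by
  classical
  obtain ⟨r, hr, hball⟩ := Metric.isOpen_iff.1 hD z.fst hz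
  obtain ⟨huC, K, hK⟩ := hu
  have hdiff : ∀ x ∈ D, DifferentiableAt ℝ u x := fun x hx =>
    (huC.differentiableOn (by norm_num)).differentiableAt (hD.mem_nhds hx)
  have hlip : LipschitzOnWith (‖fderiv ℝ u z.fst‖₊ + K * r.toNNReal) u (ball z.fst r) := by
    refine (convex_ball z.fst r).lipschitzOnWith_of_nnnorm_fderiv_le (𝕜 := ℝ)
      (fun x hx => hdiff x (hball hx)) fun x hx => ?_
    have h1 := hK.dist_le_mul x (hball hx) z.fst hz
    have h2 : dist x z.fst < r := hx
    rw [← NNReal.coe_le_coe]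
    push_cast
    rw [Real.coe_toNNReal r hr.le]
    have h3 := norm_le_norm_add_norm_sub (fderiv ℝ u z.fst) (fderiv ℝ u x)
    rw [← dist_eq_norm, dist_comm] at h3
    have h4 : (K : ℝ) * dist x z.fst ≤ K * r := by gcongr
    linarith
  -- Charts require a globally Lipschitz g; only its values on the ball matter.
  obtain ⟨g, hgL, hug⟩ := hlip.extend_real
  refine ⟨{w | w.fst ∈ ball z.fst r ∧ 0 < w.snd}, LinearIsometryEquiv.refl ℝ _, g,
    fun h => D.piecewise (uₕ h) 0, ⟨mem_ball_self hr, by rwa [hz1]⟩, ?_⟩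
  constructor
  · exact (isOpen_ball.preimage continuous_graphSpace_fst).inter
      (isOpen_lt continuous_const continuous_graphSpace_snd)
  · exact ⟨_, hgL⟩
  · exact fun h => measurable_piecewise_zero hD (huₕ h).1.continuousOn
  · rintro p t ⟨h1, h2⟩
    have h1' : p ∈ ball z.fst r := h1
    refine ⟨fun ht => ⟨hball h1, h2.le, ?_⟩, fun ht h => ?_⟩
    · change t ≤ u p
      rw [hug h1']
      exact ht.le
    · have h3 : t ≤ u p := h.2.2
      rw [hug h1'] at h3
      exact ht.not_ge h3
  · refine Eventually.of_forall fun h => ?_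
    rintro p t ⟨h1, h2⟩
    have h1' : p ∈ D := hball h1
    rw [piecewise_eq_of_mem _ _ _ h1']
    exact ⟨fun ht => ⟨h1', h2.le, ht.le⟩, fun ht h => ht.not_ge h.2.2⟩
  · rintro p ⟨h1, h2⟩
    have h1' : p ∈ ball z.fst r := h1
    rw [← hug h1']
    refine (hconv.1.tendsto_at (hball h1')).congr fun h => ?_
    rw [piecewise_eq_of_mem _ _ _ (hball h1')]
  · rintro p ⟨h1, h2⟩ - q
    have h1' : p ∈ ball z.fst r := h1
    have hfd : fderiv ℝ g p = fderiv ℝ u p :=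
      Filter.EventuallyEq.fderiv_eq (eventually_of_mem (isOpen_ball.mem_nhds h1') fun x hx =>
        (hug hx).symm)
    rw [hfd]
    refine (tendsto_slope_of_tendstoInC1On huC hD (fun h => (huₕ h).1) hconv hε hε_pos
      (hball h1') q).congr' ?_
    have h3 : Tendsto (fun h => p - ε h • q) atTop (𝓝 p) := by
      have := (tendsto_const_nhds (x := p)).sub (hε.smul_const q)
      simpa using this
    filter_upwards [h3.eventually (hD.mem_nhds (hball h1'))] with h hh
    rw [piecewise_eq_of_mem _ _ _ (hball h1'), piecewise_eq_of_mem _ _ _ hh]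

end Charts

/-! ### Functions with bounded gradient near a Lipschitz boundary. -/

section LipschitzDomain

variable {W : Type*} [NormedAddCommGroup W] [InnerProductSpace ℝ W]

theorem norm_image_sub_le_of_segment_subset {D : Set W} {u : W → ℝ} {M : ℝ}
    (hu : ∀ x ∈ D, DifferentiableAt ℝ u x) (hM : ∀ x ∈ D, ‖fderiv ℝ u x‖ ≤ M) {a b : W}
    (hab : segment ℝ a b ⊆ D) : ‖u b - u a‖ ≤ M * ‖b - a‖ :=
  (convex_segment a b).norm_image_sub_le_of_norm_fderiv_le (𝕜 := ℝ) (fun x hx => hu x (hab hx))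
    (fun x hx => hM x (hab hx)) (left_mem_segment ℝ a b) (right_mem_segment ℝ a b)

/-- A function with bounded derivative on a domain which is the region below a Lipschitz graph near
`x₀` is Lipschitz near `x₀`. -/
theorem exists_lipschitzOnWith_inter_ball {D : Set W} {u : W → ℝ} {M : ℝ}
    (hu : ∀ x ∈ D, DifferentiableAt ℝ u x) (hM0 : 0 ≤ M) (hM : ∀ x ∈ D, ‖fderiv ℝ u x‖ ≤ M)
    {x₀ : W} {r : ℝ} (hr : 0 < r) {K : ℝ≥0} {g : W → ℝ} (hg : LipschitzWith K g) {e : W}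
    (he : ‖e‖ = 1)
    (hDg : ∀ x ∈ ball x₀ r, (x ∈ D ↔ inner ℝ x e < g (x - (inner ℝ x e : ℝ) • e))) :
    ∃ r' : ℝ, 0 < r' ∧ r' ≤ r ∧ ∃ C : ℝ≥0, LipschitzOnWith C u (D ∩ ball x₀ r') := by
  have hee : inner ℝ e e = (1 : ℝ) := by rw [real_inner_self_eq_norm_sq, he]; norm_num
  have hK : (0 : ℝ) ≤ K := K.2
  set r' := r / (4 * K + 4) with hr'
  have hr'0 : 0 < r' := by positivity
  have hrr' : r = (4 * K + 4) * r' := by rw [hr']; field_simp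
  have hvert : ∀ (x : W) (τ : ℝ), inner ℝ (x - τ • e) e = inner ℝ x e - τ := fun x τ => by
    rw [inner_sub_left, real_inner_smul_left, hee, mul_one]
  have hhor : ∀ (x : W) (τ : ℝ), (x - τ • e) - (inner ℝ x e - τ) • e =
      x - (inner ℝ x e : ℝ) • e := fun x τ => by
    rw [sub_smul]
    abel
  have hdown : ∀ x (δ : ℝ), 0 ≤ δ → x ∈ D → x ∈ ball x₀ r → x - δ • e ∈ ball x₀ r →
      segment ℝ x (x - δ • e) ⊆ D := by
    intro x δ hδ hxD hx hx' y hy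
    have hyb := (convex_ball x₀ r).segment_subset hx hx' hy
    obtain ⟨θ, hθ, rfl⟩ := (segment_eq_image' ℝ x (x - δ • e)) ▸ hy
    have hy' : x + θ • (x - δ • e - x) = x - (θ * δ) • e := by
      rw [sub_sub_cancel_left, smul_neg, smul_smul, sub_eq_add_neg]
    simp only [hy'] at hyb ⊢
    rw [hDg _ hyb, hvert, hhor]
    have h1 := (hDg x hx).1 hxD
    -- Moving along -e keeps the horizontal part and lowers the vertical coordinate, so it stays
    -- under the graph of g.
    have h2 := mul_nonneg hθ.1 hδ
    linarith
  refine ⟨r', hr'0, by rw [hrr']; nlinarith, (M * (4 * K + 3)).toNNReal,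
    LipschitzOnWith.of_dist_le_mul ?_⟩
  rintro x ⟨hxD, hx⟩ y ⟨hyD, hy⟩
  rw [Real.coe_toNNReal _ (by positivity), dist_comm, dist_comm x y, dist_eq_norm, dist_eq_norm]
  set d := ‖y - x‖ with hd
  have hd0 : 0 ≤ d := norm_nonneg _
  rw [mem_ball, dist_eq_norm] at hx hy
  have hd2 : d ≤ 2 * r' := by
    have := norm_sub_le (y - x₀) (x - x₀)
    rw [sub_sub_sub_cancel_right] at this
    linarith
  -- The path x → x - δe → y - δe → y has length (4K + 3)d. Along the middle leg the horizontal part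
  -- moves by at most 2d, so g drops by at most 2Kd, while the vertical coordinate rises by at most
  -- d: descending by (2K + 1)d compensates both. Since d ≤ 2r', the path stays within (4K + 3)r' <
  -- r of x₀.
  set δ := (2 * K + 1) * d with hδ
  have hδ0 : 0 ≤ δ := by positivity
  have hball : ∀ z : W, ‖z - x₀‖ < r' → z ∈ ball x₀ r ∧ z - δ • e ∈ ball x₀ r := by
    intro z hz
    rw [mem_ball, mem_ball, dist_eq_norm, dist_eq_norm]
    have h1 : ‖z - δ • e - x₀‖ ≤ ‖z - x₀‖ + δ := by
      have := norm_sub_le (z - x₀) (δ • e)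
      rw [norm_smul, he, mul_one, Real.norm_of_nonneg hδ0, sub_right_comm] at this
      exact this
    constructor <;> nlinarith
  obtain ⟨hx1, hx2⟩ := hball x hx
  obtain ⟨hy1, hy2⟩ := hball y hy
  have hacross : segment ℝ (x - δ • e) (y - δ • e) ⊆ D := by
    intro w hw
    have hwb := (convex_ball x₀ r).segment_subset hx2 hy2 hw
    obtain ⟨θ, hθ, rfl⟩ := (segment_eq_image' ℝ (x - δ • e) (y - δ • e)) ▸ hw
    have hw' : x - δ • e + θ • (y - δ • e - (x - δ • e)) = (x + θ • (y - x)) - δ • e := by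
      rw [sub_sub_sub_cancel_right]
      abel
    simp only [hw'] at hwb ⊢
    rw [hDg _ hwb, hvert, hhor]
    have h1 := (hDg x hx1).1 hxD
    set w' := x + θ • (y - x)
    have h2 : ‖w' - x‖ ≤ d := by
      simp only [w', add_sub_cancel_left]
      rw [norm_smul, Real.norm_of_nonneg hθ.1]
      exact mul_le_of_le_one_left hd0 hθ.2
    have h3 : |inner ℝ w' e - inner ℝ x e| ≤ d := by
      rw [← inner_sub_left]
      refine (abs_real_inner_le_norm _ _).trans ?_
      rwa [he, mul_one]
    have h4 := hg.dist_le_mul (w' - (inner ℝ w' e : ℝ) • e) (x - (inner ℝ x e : ℝ) • e)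
    rw [Real.dist_eq, dist_eq_norm] at h4
    have h5 : ‖w' - (inner ℝ w' e : ℝ) • e - (x - (inner ℝ x e : ℝ) • e)‖ ≤ 2 * d := by
      have h6 : w' - (inner ℝ w' e : ℝ) • e - (x - (inner ℝ x e : ℝ) • e) =
          (w' - x) - (inner ℝ w' e - inner ℝ x e : ℝ) • e := by
        rw [sub_smul]
        abel
      rw [h6]
      refine (norm_sub_le _ _).trans ?_
      rw [norm_smul, he, mul_one, Real.norm_eq_abs]
      linarith
    have h7 := (abs_le.1 (h4.trans (mul_le_mul_of_nonneg_left h5 hK))).1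
    have h8 := (abs_le.1 h3).2
    rw [hδ]
    linarith
  have e1 := norm_image_sub_le_of_segment_subset hu hM (hdown x δ hδ0 hxD hx1 hx2)
  have e2 := norm_image_sub_le_of_segment_subset hu hM hacross
  have e3 := norm_image_sub_le_of_segment_subset hu hM (hdown y δ hδ0 hyD hy1 hy2)
  rw [sub_sub_cancel_left, norm_neg, norm_smul, he, mul_one, Real.norm_of_nonneg hδ0,
    Real.norm_eq_abs] at e1 e3
  rw [sub_sub_sub_cancel_right, Real.norm_eq_abs] at e2
  rw [Real.norm_eq_abs]
  have h9 : M * (4 * K + 3) * d = M * δ + M * d + M * δ := by rw [hδ]; ring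
  rw [h9, abs_le]
  constructor <;> linarith [(abs_le.1 e1).1, (abs_le.1 e1).2, (abs_le.1 e2).1, (abs_le.1 e2).2,
    (abs_le.1 e3).1, (abs_le.1 e3).2]

theorem IsC11On.exists_norm_fderiv_le {D : Set W} {u : W → ℝ} (hu : IsC11On u D)
    (hD : Bornology.IsBounded D) : ∃ M, 0 ≤ M ∧ ∀ x ∈ D, ‖fderiv ℝ u x‖ ≤ M := by
  obtain ⟨-, K, hK⟩ := hu
  obtain ⟨C, hC⟩ := Metric.isBounded_iff.1 hD
  rcases D.eq_empty_or_nonempty with rfl | ⟨x₁, hx₁⟩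
  · exact ⟨0, le_rfl, by simp⟩
  have hC0 : 0 ≤ C := dist_nonneg.trans (hC hx₁ hx₁)
  refine ⟨‖fderiv ℝ u x₁‖ + K * C, by positivity, fun x hx => ?_⟩
  have h1 := hK.dist_le_mul x hx x₁ hx₁
  have h2 := norm_le_norm_add_norm_sub (fderiv ℝ u x₁) (fderiv ℝ u x)
  rw [← dist_eq_norm, dist_comm] at h2
  have h3 : (K : ℝ) * dist x x₁ ≤ K * C := mul_le_mul_of_nonneg_left (hC hx hx₁) K.2
  linarith

/-- One inequality passes to the closure of D; the other holds because an open set misses its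
frontier. -/
theorem inner_eq_of_mem_frontier {D : Set W} (hD : IsOpen D) {x₀ : W} {r : ℝ} {g : W → ℝ}
    (hg : Continuous g) {e : W}
    (hDg : ∀ x ∈ ball x₀ r, (x ∈ D ↔ inner ℝ x e < g (x - (inner ℝ x e : ℝ) • e))) {x : W}
    (hx : x ∈ frontier D) (hxr : x ∈ ball x₀ r) :
    inner ℝ x e = g (x - (inner ℝ x e : ℝ) • e) := by
  have hxD : x ∉ D := by
    rw [hD.frontier_eq] at hx
    exact hx.2
  refine le_antisymm ?_ (not_lt.1 fun h => hxD ((hDg x hxr).2 h))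
  have hclosed : IsClosed {y : W | inner ℝ y e ≤ g (y - (inner ℝ y e : ℝ) • e)} :=
    isClosed_le (by fun_prop) (hg.comp (by fun_prop))
  have hmem : x ∈ closure (ball x₀ r ∩ D) :=
    isOpen_ball.inter_closure ⟨hxr, frontier_subset_closure hx⟩
  exact hclosed.closure_subset_iff.2 (fun y hy => ((hDg y hy.1).1 hy.2).le) hmem

end LipschitzDomain

/-! ### The edges are null, and charts exist elsewhere. -/

section Main

variable {n : ℕ}

/-- The points of a lateral boundary which lie on a horizontal graph form a null set. -/
theorem euclideanHausdorffMeasure_lateral_inter_graph_eq_zero {K : ℝ≥0}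
    {g v : EuclideanSpace ℝ (Fin n) → ℝ} (hg : LipschitzWith K g) (hv : Continuous v)
    {e : EuclideanSpace ℝ (Fin n)} (he : ‖e‖ = 1) :
    (μHE[n] : Measure (GraphSpace n))
      {z | inner ℝ z.fst e = g (z.fst - (inner ℝ z.fst e : ℝ) • e) ∧ z.snd = v z.fst} = 0 := by
  obtain ⟨Φ, hΦ⟩ := exists_linearIsometryEquiv_apply_eq (e := WithLp.toLp 2 (e, (0 : ℝ)))
    (by rw [WithLp.prod_norm_eq_of_L2]; simp [he])
  set g' : EuclideanSpace ℝ (Fin n) → ℝ := fun q => g (Φ (WithLp.toLp 2 (q, 0))).fst with hg'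
  have hlip : LipschitzWith K g' := lipschitzWith_comp_chart_fst hg Φ
  have hinner : ∀ q t, inner ℝ (Φ (WithLp.toLp 2 (q, t))).fst e = t := by
    intro q t
    have := inner_chart Φ q t
    rw [hΦ, WithLp.prod_inner_apply] at this
    simpa using this
  have hfst : ∀ q t, (Φ (WithLp.toLp 2 (q, t))).fst - t • e = (Φ (WithLp.toLp 2 (q, 0))).fst := by
    intro q t
    rw [chart_eq_add Φ q t, hΦ]
    simp
  have hφ := lipschitzWith_of_dist_sq_eq hlip (dist_graphParam_sq Φ g')
  set B : Set (EuclideanSpace ℝ (Fin n)) :=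
    {q | (graphParam Φ g' q).snd = v (graphParam Φ g' q).fst} with hB
  have hBc : IsClosed B := isClosed_eq (continuous_graphSpace_snd.comp hφ.continuous)
    (hv.comp (continuous_graphSpace_fst.comp hφ.continuous))
  -- The wall is a vertical cylinder: w is the parameter direction along which its points move
  -- straight up.
  obtain ⟨w, t, hw⟩ := exists_eq_chart Φ (WithLp.toLp 2 ((0 : EuclideanSpace ℝ (Fin n)), (1 : ℝ)))
  have ht : t = 0 := by
    rw [← hinner w t, ← hw]
    simp
  subst ht
  have htrans : ∀ q (s : ℝ), graphParam Φ g' (q + s • w) =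
      graphParam Φ g' q + s • WithLp.toLp 2 ((0 : EuclideanSpace ℝ (Fin n)), (1 : ℝ)) := by
    intro q s
    have h1 : Φ (WithLp.toLp 2 (q + s • w, (0 : ℝ))) = Φ (WithLp.toLp 2 (q, 0)) +
        s • WithLp.toLp 2 ((0 : EuclideanSpace ℝ (Fin n)), (1 : ℝ)) := by
      have h := chart_sub_smul Φ q w 0 0 (-s)
      rw [neg_smul, neg_smul, sub_neg_eq_add, sub_neg_eq_add, mul_zero, sub_zero] at h
      rw [hw, h]
    have h2 : g' (q + s • w) = g' q := by
      simp only [hg', h1]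
      simp
    rw [graphParam, graphParam, h2, chart_eq_add Φ (q + s • w), h1, chart_eq_add Φ q (g' q)]
    abel
  -- Along each line parallel to w the height grows at unit speed while v of the base point is
  -- constant, so the line meets B at most once; Fubini concludes.
  have hBnull : volume B = 0 := by
    have h := ae_mem_of_ae_add_linearMap_mem ((LinearMap.id : ℝ →ₗ[ℝ] ℝ).smulRight w)
      (volume : Measure ℝ) (volume : Measure (EuclideanSpace ℝ (Fin n)))
      hBc.isOpen_compl.measurableSet fun q => ?_
    · simpa [ae_iff] using h
    · rw [ae_iff]
      refine Set.Subsingleton.measure_zero ?_ _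
      intro s hs s' hs'
      simp only [LinearMap.smulRight_apply, LinearMap.id_apply, mem_compl_iff, not_not,
        hB, mem_ofPred_eq, htrans] at hs hs'
      simp at hs hs'
      linarith
  refine measure_mono_null ?_ (euclideanHausdorffMeasure_image_eq_zero hφ hBnull)
  rintro z ⟨hz1, hz2⟩
  obtain ⟨q, t, rfl⟩ := exists_eq_chart Φ z
  rw [hinner, hfst] at hz1
  have hz3 : graphParam Φ g' q = Φ (WithLp.toLp 2 (q, t)) := by rw [graphParam, hz1]
  refine ⟨q, ?_, hz3⟩
  rw [hB, mem_ofPred_eq, hz3]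
  exact hz2

variable {D : Set (EuclideanSpace ℝ (Fin n))} {u : EuclideanSpace ℝ (Fin n) → ℝ}

theorem mem_closure_of_mem_frontier_subgraphOver {z : GraphSpace n}
    (hz : z ∈ frontier (subgraphOver D u)) : z.fst ∈ closure D ∧ 0 ≤ z.snd := by
  have h := frontier_subset_closure hz
  constructor
  · exact map_mem_closure continuous_graphSpace_fst h fun w hw => hw.1
  · have hc : IsClosed {w : GraphSpace n | 0 ≤ w.snd} :=
      isClosed_le continuous_const continuous_graphSpace_snd
    exact hc.closure_subset_iff.2 (fun w hw => hw.2.1) h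

theorem snd_eq_of_mem_frontier_subgraphOver (hD : IsOpen D) (hu : ContinuousOn u D)
    {z : GraphSpace n} (hz : z ∈ frontier (subgraphOver D u)) (hzD : z.fst ∈ D) :
    z.snd = 0 ∨ z.snd = u z.fst := by
  have h0 := (mem_closure_of_mem_frontier_subgraphOver hz).2
  have hcont : ContinuousAt (fun w : GraphSpace n => u w.fst) z :=
    ContinuousAt.comp (f := fun w : GraphSpace n => w.fst) (hu.continuousAt (hD.mem_nhds hzD))
      continuous_graphSpace_fst.continuousAt
  have hnear : ∀ᶠ w : GraphSpace n in 𝓝 z, w.fst ∈ D :=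
    continuous_graphSpace_fst.continuousAt.eventually (hD.mem_nhds hzD)
  by_contra! hne
  have hpos : 0 < z.snd := lt_of_le_of_ne h0 hne.1.symm
  rcases hne.2.lt_or_gt with h | h
  · refine hz.2 (mem_interior_iff_mem_nhds.2 ?_)
    filter_upwards [hnear, continuous_graphSpace_snd.continuousAt.eventually (lt_mem_nhds hpos),
      continuous_graphSpace_snd.continuousAt.eventually_lt hcont h] with w h1 h2 h3
    exact ⟨h1, h2.le, h3.le⟩
  · obtain ⟨w, hw, hwE⟩ := mem_closure_iff_nhds.1 (frontier_subset_closure hz) _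
      (hcont.eventually_lt continuous_graphSpace_snd.continuousAt h)
    exact hwE.2.2.not_gt hw

/-- The bound y ≤ u(x) reaches limit points over ∂D only through a continuous extension v of u. -/
theorem snd_le_of_mem_closure_subgraphOver {x₀ : EuclideanSpace ℝ (Fin n)} {r : ℝ}
    {v : EuclideanSpace ℝ (Fin n) → ℝ} (hv : Continuous v) (huv : EqOn u v (D ∩ ball x₀ r))
    {z : GraphSpace n} (hz : z ∈ closure (subgraphOver D u)) (hzr : z.fst ∈ ball x₀ r) :
    z.snd ≤ v z.fst := by
  have hclosed : IsClosed {w : GraphSpace n | w.snd ≤ v w.fst} :=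
    isClosed_le continuous_graphSpace_snd (hv.comp continuous_graphSpace_fst)
  have hmem : z ∈ closure ((fun w : GraphSpace n => w.fst) ⁻¹' ball x₀ r ∩ subgraphOver D u) :=
    (isOpen_ball.preimage continuous_graphSpace_fst).inter_closure ⟨hzr, hz⟩
  refine hclosed.closure_subset_iff.2 (fun w hw => ?_) hmem
  change w.snd ≤ v w.fst
  rw [← huv ⟨hw.2.1, hw.1⟩]
  exact hw.2.2.2

/-- Almost every point of the reduced boundary of the subgraph lies in a graph chart. -/
theorem exists_null_forall_exists_isGraphChart (hD : IsOpen D) (hDb : Bornology.IsBounded D)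
    (hDlip : HasLipschitzBoundary D) {uₕ : ℕ → EuclideanSpace ℝ (Fin n) → ℝ}
    (huₕ : ∀ h, IsC11On (uₕ h) D) (hu : IsC11On u D) (hu_pos : ∀ x ∈ D, 0 < u x)
    (hconv : TendstoInC1On uₕ u D) {ε : ℕ → ℝ} (hε_pos : ∀ h, 0 < ε h)
    (hε : Tendsto ε atTop (𝓝 0)) :
    ∃ N : Set (GraphSpace n), (μHE[n] : Measure (GraphSpace n)) N = 0 ∧
      ∀ z ∈ reducedBoundary (subgraphOver D u) \ N, ∃ U Φ g gₕ, z ∈ U ∧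
        IsGraphChart ε (subgraphOver D u) (fun h => subgraphOver D (uₕ h)) U Φ g gₕ := by
  set P : GraphSpace n → Prop := fun z => ∃ U Φ g gₕ, z ∈ U ∧
    IsGraphChart ε (subgraphOver D u) (fun h => subgraphOver D (uₕ h)) U Φ g gₕ
  have hdiff : ∀ x ∈ D, DifferentiableAt ℝ u x := fun x hx =>
    (hu.1.differentiableOn (by norm_num)).differentiableAt (hD.mem_nhds hx)
  obtain ⟨M, hM0, hM⟩ := hu.exists_norm_fderiv_le hDb
  have hfrontier : ∀ z ∈ frontier (subgraphOver D u), ¬ P z → z.fst ∈ frontier D := by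
    intro z hz hPz
    rw [hD.frontier_eq]
    refine ⟨(mem_closure_of_mem_frontier_subgraphOver hz).1, fun hzD => hPz ?_⟩
    rcases snd_eq_of_mem_frontier_subgraphOver hD hu.1.continuousOn hz hzD with h | h
    · exact exists_isGraphChart_bottom hD hu.1.continuousOn hconv.1 hε hε_pos hzD h
        (hu_pos _ hzD)
    · exact exists_isGraphChart_top hD hu huₕ hconv hε hε_pos hzD h (hu_pos _ hzD)
  refine ⟨{z | z ∈ frontier (subgraphOver D u) ∧ ¬ P z}, ?_, fun z hz => ?_⟩
  swap
  · by_contra h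
    exact hz.2 ⟨reducedBoundary_subset_frontier _ hz.1, h⟩
  -- Points without a chart lie over ∂D. Near one of them, a wall point strictly between 0 and v
  -- would have a lateral chart, so only the bottom and top edges remain.
  refine measure_null_of_locally_null _ fun z hz => ?_
  obtain ⟨r, hr, e, he, K, g, hg, hDg⟩ := hDlip z.fst (hfrontier z hz.1 hz.2)
  obtain ⟨r', hr', hrr', C, hC⟩ :=
    exists_lipschitzOnWith_inter_ball hdiff hM0 hM hr hg he hDg
  obtain ⟨v, hvL, huv⟩ := hC.extend_real
  have hDg' : ∀ x ∈ ball z.fst r', (x ∈ D ↔ inner ℝ x e < g (x - (inner ℝ x e : ℝ) • e)) :=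
    fun x hx => hDg x (ball_subset_ball hrr' hx)
  obtain ⟨Φ, hΦ⟩ := exists_linearIsometryEquiv_apply_eq (e := WithLp.toLp 2 (e, (0 : ℝ)))
    (by rw [WithLp.prod_norm_eq_of_L2]; simp [he])
  refine ⟨_, inter_mem_nhdsWithin _ ((isOpen_ball.preimage continuous_graphSpace_fst).mem_nhds
    (mem_ball_self hr' : z.fst ∈ ball z.fst r')), ?_⟩
  refine measure_mono_null (t :=
    {z | inner ℝ z.fst e = g (z.fst - (inner ℝ z.fst e : ℝ) • e) ∧ z.snd = 0} ∪
    {z | inner ℝ z.fst e = g (z.fst - (inner ℝ z.fst e : ℝ) • e) ∧ z.snd = v z.fst}) ?_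
    (measure_union_null
      (euclideanHausdorffMeasure_lateral_inter_graph_eq_zero hg (v := 0) continuous_zero he)
      (euclideanHausdorffMeasure_lateral_inter_graph_eq_zero hg hvL.continuous he))
  rintro w ⟨⟨hw, hPw⟩, hwr⟩
  have hwr' : w.fst ∈ ball z.fst r' := hwr
  have h1 := inner_eq_of_mem_frontier hD hg.continuous hDg' (hfrontier w hw hPw) hwr'
  have h2 := (mem_closure_of_mem_frontier_subgraphOver hw).2
  have h3 := snd_le_of_mem_closure_subgraphOver hvL.continuous huv (frontier_subset_closure hw) hwr'
  by_contra hcon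
  simp only [mem_union, mem_ofPred_eq, not_or, not_and] at hcon
  refine hPw ?_
  obtain ⟨U, g', gₕ, hc⟩ := exists_isGraphChart_lateral hconv.1 hε hε_pos hg hDg'
    hvL.continuous huv hΦ hwr' (lt_of_le_of_ne h2 (Ne.symm (hcon.1 h1)))
    (lt_of_le_of_ne h3 (hcon.2 h1))
  exact ⟨U, Φ, g', gₕ, hc⟩

end Main

/-! ### Replacing f by a profile continuous on the whole line. -/

section ContinuousProfile

variable {V : Type*} [NormedAddCommGroup V] [InnerProductSpace ℝ V] [FiniteDimensional ℝ V]
  [MeasurableSpace V] [BorelSpace V] {G : V → ℝ} {f : ℝ → ℝ}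

/-- In both functionals f is evaluated only at nonnegative numbers, so precomposing with the
positive part changes neither and gives the global continuity used for measurability and limits. -/
theorem IsInteractionProfile.continuous_comp_max (hf : IsInteractionProfile f) :
    Continuous fun x => f (max x 0) :=
  hf.continuousOn.comp_continuous (by fun_prop) fun x => le_max_right x 0

theorem nonlocalEnergy_comp_max (hG : IsInteractionKernel G) (f : ℝ → ℝ) (Ω : Set V) {ε : ℝ}
    (hε : 0 < ε) (E : Set V) :
    nonlocalEnergy G (fun x => f (max x 0)) Ω ε E = nonlocalEnergy G f Ω ε E := by
  unfold nonlocalEnergy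
  congr 1
  refine lintegral_congr fun x => ?_
  exact congrArg (fun y => ENNReal.ofReal (f y))
    (max_eq_left (kernelAverage_nonneg hG hε (E ∩ Ω) x))

theorem surfaceDensity_comp_max (hG : IsInteractionKernel G) (f : ℝ → ℝ) (ν : V) :
    surfaceDensity G (fun x => f (max x 0)) ν = surfaceDensity G f ν := by
  unfold surfaceDensity
  congr 1
  ext t
  exact congrArg f (max_eq_left (integral_nonneg hG.nonneg))

end ContinuousProfile

end

theorem theorem3p2 (n : ℕ) (hn : 1 ≤ n)
    (G : WithLp 2 (EuclideanSpace ℝ (Fin n) × ℝ) → ℝ) (hG : IsInteractionKernel G)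
    (f : ℝ → ℝ) (hf : IsInteractionProfile f)
    (Ω : Set (WithLp 2 (EuclideanSpace ℝ (Fin n) × ℝ)))
    (hΩ_open : IsOpen Ω) (hΩ_bdd : Bornology.IsBounded Ω)
    (D : Set (EuclideanSpace ℝ (Fin n)))
    (hD_open : IsOpen D) (hD_bdd : Bornology.IsBounded D) (hD_lip : HasLipschitzBoundary D)
    (uₕ : ℕ → EuclideanSpace ℝ (Fin n) → ℝ) (u : EuclideanSpace ℝ (Fin n) → ℝ)
    (huₕ : ∀ h, IsC11On (uₕ h) D) (hu : IsC11On u D)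
    (huₕ_pos : ∀ h, ∀ x ∈ D, 0 < uₕ h x) (hu_pos : ∀ x ∈ D, 0 < u x)
    (hconv : TendstoInC1On uₕ u D)
    (ε : ℕ → ℝ) (hε_pos : ∀ h, 0 < ε h) (hε : Tendsto ε atTop (𝓝 0)) :
    anisotropicPerimeter G f Ω (subgraphOver D u) ≤
      liminf (fun h => nonlocalEnergy G f Ω (ε h) (subgraphOver D (uₕ h))) atTop := by
  obtain ⟨N, hN, hcharts⟩ := exists_null_forall_exists_isGraphChart hD_open hD_bdd hD_lip huₕ hu
    hu_pos hconv hε_pos hε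
  have h := anisotropicPerimeter_le_liminf_of_charts hG hf.continuous_comp_max hΩ_open
    (measurableSet_subgraphOver hD_open hu.1.continuousOn)
    (fun h => measurableSet_subgraphOver hD_open (huₕ h).1.continuousOn) hε_pos hε hN hcharts
  simpa only [anisotropicPerimeter, surfaceDensity_comp_max hG,
    nonlocalEnergy_comp_max hG f Ω (hε_pos _)] using h
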